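/- Let $L$ be a countable first-order language and let $M=\langle M,<,+,\cdot,\dots\rangle$ be an $L$-structure that is an o-minimal expansion of a real closed field (not necessarily power bounded): $L$ contains symbols interpreted as the order, the addition and the multiplication of the field, and every subset of $M$ definable with parameters is a finite union of points and open intervals with endpoints in $M\cup\{\pm\infty\}$. Let $v$ be the natural valuation of $M$, that is, $v(0)=\infty$, two nonzero elements $x,y$ have the same value iff $n|x|\ge |y|$ and $n|y|\ge|x|$ for some $n\in\mathbb N$, and $v(x)<v(y)$ iff $n|y|<|x|$ for all $n\in\mathbb N$. Let $G=v(M\setminus\{0\})$ be its value group, ordered by $<$ and with operation $v(x)+v(y)=v(xy)$, and let $k$ be its residue field, the quotient of $\{x: v(x)\ge 0\}$ by $\{x: v(x)>0\}$, ordered by the order induced from $M$. For $A\subseteq M$ let $\operatorname{dcl}(A)$ be the union of all singletons definable with parameters in $A$, and let $P=\operatorname{dcl}(\emptyset)$ be the prime model. A basis over $P$ of a subset $S\subseteq M$ is a set $B\subseteq S$ such that $S\subseteq\operatorname{dcl}(P\cup B)$ and $b\notin\operatorname{dcl}(P\cup(B\setminus\{b\}))$ for all $b\in B$; $\dim(S/P)$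 is the cardinality of such a basis. A structure is $\kappa$-saturated if every $1$-type (finitely satisfiable set of formulas in one variable) over fewer than $\kappa$ parameters is realized in it. For an infinite ordinal $\lambda$, a sequence $(a_\rho)_{\rho<\lambda}$ is pseudo-Cauchy if $v(a_\sigma-a_\rho)<v(a_\tau-a_\sigma)$ for all $\rho<\sigma<\tau<\lambda$, and $x$ is a pseudo-limit of it if $v(x-a_\rho)=v(a_\sigma-a_\rho)$ for all $\rho<\sigma<\lambda$. Let $\alpha$ be an ordinal. Then $M$ is $\aleph_\alpha$-saturated if and only if for every $L$-substructure $M'\subseteq M$ with $\dim(M'/P)<\aleph_\alpha$ the following three conditions hold: 1. $G\neq\{0\}$, and the structure $(G,<,+,v(M'))$, that is, the ordered group $(G,<,+)$ expanded by a constant symbol for each element of $v(M'\setminus\{0\})$, is $\aleph_\alpha$-saturated; 2. $k\cong\mathbb R$ (as ordered fields); 3. every pseudo-Cauchy sequence in $M'$ has a pseudo-limit in $M$. -/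

import Mathlib

open FirstOrder Cardinal Ordinal

universe u v w

namespace OMinSat

section ModelTheory

variable (L : FirstOrder.Language.{u, v}) (M : Type w) [L.Structure M]

/-- `M` is `κ`-saturated: for every parameter set `A ⊆ M` with `|A| < κ`, every `1`-type over `A`
(a set of formulas in one free variable with parameters from `A`, finitely satisfiable in `M`)
is realized in `M`. -/
def IsSaturated (κ : Cardinal.{w}) : Prop :=
  ∀ A : Set M, #A < κ → ∀ p : Set (L[[A]].Formula Unit),
    (∀ q : Finset (L[[A]].Formula Unit), (q : Set (L[[A]].Formula Unit)) ⊆ p →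
      ∃ x : M, ∀ φ ∈ q, φ.Realize (fun _ => x)) →
    ∃ x : M, ∀ φ ∈ p, φ.Realize (fun _ => x)

variable {M}

/-- Definable closure: the union of the `A`-definable singletons. -/
def dcl (A : Set M) : Set M :=
  {a | A.Definable₁ L ({a} : Set M)}

/-- `B` is `dcl`-independent over `A`. -/
def IsIndepOver (A B : Set M) : Prop :=
  ∀ b ∈ B, b ∉ dcl L (A ∪ (B \ {b}))

/-- `B` is a basis of `S` over `A`: it is contained in `S`, independent over `A`, and together
with `A` it generates `S`. -/
def IsBasisOver (A S B : Set M) : Prop :=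
  B ⊆ S ∧ IsIndepOver L A B ∧ S ⊆ dcl L (A ∪ B)

variable (M) in
/-- The underlying set of the prime model, `dcl ∅`. -/
def primeModel : Set M := dcl L (∅ : Set M)

/-- `dim (S / P) < κ`, where `P` is the prime model and the dimension of `S` over `P` is the
cardinality of a basis of `S` over `P` (in an o-minimal structure bases exist, and any two of
them are equinumerous). -/
def DimOverPrimeLT (S : Set M) (κ : Cardinal.{w}) : Prop :=
  ∃ B : Set M, IsBasisOver L (primeModel L M) S B ∧ #B < κ

/-- Points and open intervals with endpoints in `M ∪ {-∞, +∞}`. -/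
def IsPointOrOpenInterval [LinearOrder M] (I : Set M) : Prop :=
  (∃ a, I = {a}) ∨ (∃ a b, I = Set.Ioo a b) ∨ (∃ a, I = Set.Iio a) ∨ (∃ a, I = Set.Ioi a) ∨
    I = Set.univ

variable (M) in
/-- Every subset of `M` definable with parameters in `M` is a finite union of points and open
intervals with endpoints in `M ∪ {-∞, +∞}`. -/
def IsOMinimal [LinearOrder M] : Prop :=
  ∀ s : Set M, (Set.univ : Set M).Definable₁ L s →
    ∃ F : Set (Set M), F.Finite ∧ (∀ I ∈ F, IsPointOrOpenInterval I) ∧ s = ⋃₀ F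

variable (M) in
/-- The `L`-structure on the ordered field `M` expands `⟨M, <, +, ·⟩`: among the symbols of `L`
there are symbols for `<`, `+` and `·`, interpreted in `M` as the order and the field
operations. -/
structure ExpandsOrderedField [Field M] [LinearOrder M] : Prop where
  lt_symbol : ∃ r : L.Relations 2, ∀ x : Fin 2 → M,
    FirstOrder.Language.Structure.RelMap r x ↔ x 0 < x 1
  add_symbol : ∃ f : L.Functions 2, ∀ x : Fin 2 → M,
    FirstOrder.Language.Structure.funMap f x = x 0 + x 1
  mul_symbol : ∃ f : L.Functions 2, ∀ x : Fin 2 → M,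
    FirstOrder.Language.Structure.funMap f x = x 0 * x 1

end ModelTheory

section OrderedGroupLanguage

/-- The only function symbol, `+`. -/
inductive OGFunctions : ℕ → Type
  | add : OGFunctions 2

/-- The only relation symbol, `<`. -/
inductive OGRelations : ℕ → Type
  | lt : OGRelations 2

/-- The language `{<, +}` of ordered groups. -/
def ogLanguage : FirstOrder.Language.{0, 0} := ⟨OGFunctions, OGRelations⟩

end OrderedGroupLanguage

section NaturalValuation

variable (M : Type w) [Field M] [LinearOrder M] [IsStrictOrderedRing M]

/-- The value group `G` of the natural valuation `v = ArchimedeanClass.mk`: all archimedean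
classes of nonzero elements, that is, all values other than `⊤ = v 0`. Its order is the one of
`ArchimedeanClass M`, in which `v x < v y` iff `n |y| < |x|` for all `n`. -/
abbrev ValueGroup : Type w := {γ : ArchimedeanClass M // γ ≠ ⊤}

/-- The group operation of the value group, `v x + v y = v (x * y)`. -/
instance : Add (ValueGroup M) :=
  ⟨fun γ δ => ⟨γ.1 + δ.1, LinearOrderedAddCommGroupWithTop.add_ne_top.2 ⟨γ.2, δ.2⟩⟩⟩

/-- The value group as a structure `(G, <, +)`. -/
instance : ogLanguage.Structure (ValueGroup M) where
  funMap := fun {_} f => match f with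
    | .add => fun x => x 0 + x 1
  RelMap := fun {_} r => match r with
    | .lt => fun x => x 0 < x 1

variable {M}

/-- The set `v(S)` of values in the value group of the nonzero elements of `S`. -/
def valueSet (S : Set M) : Set (ValueGroup M) :=
  {γ | ∃ x ∈ S, x ≠ 0 ∧ ArchimedeanClass.mk x = γ.1}

/-- `(a_ρ)_{ρ < l}` is pseudo-Cauchy for the natural valuation. -/
def IsPseudoCauchy {l : Ordinal.{w}} (a : Set.Iio l → M) : Prop :=
  ∀ ρ σ τ : Set.Iio l, ρ < σ → σ < τ →
    ArchimedeanClass.mk (a σ - a ρ) < ArchimedeanClass.mk (a τ - a σ)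

/-- `x` is a pseudo-limit of `(a_ρ)_{ρ < l}`. -/
def IsPseudoLimit {l : Ordinal.{w}} (a : Set.Iio l → M) (x : M) : Prop :=
  ∀ ρ σ : Set.Iio l, ρ < σ →
    ArchimedeanClass.mk (x - a ρ) = ArchimedeanClass.mk (a σ - a ρ)

end NaturalValuation

end OMinSat

/-! By o-minimality, a one-variable set definable over `A` depends only on position relative to
finitely many points of `dcl L A` (`exists_determinedBy`). Realizing a 1-type over `A` thus amounts
to filling a cut over the field D = `dcl L A`. An ultrafilter extending the type presents this cut
as that of one element x of an ultrapower of M, of which only the ordered field structure matters.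

Assume x is not in D and look at the values v(x - d) for d in D. If none is greatest, a cofinal
choice of d's is a pseudo-Cauchy sequence and any pseudo-limit fills the cut. If v(x - a) is
greatest and is not a value of D, the cut is fixed by the sign of x - a and by the cut of v(x - a)
over v(D), which saturation of G fills. If v(x - a) = v(b) with b in D, the cut is fixed by the
standard part of (x - a)/b, a real number and hence a residue of M. This is `exists_sameCut`. The
values of the structure generated by x over D are never examined, so power boundedness plays no
role.

Conversely, a substructure of dimension below κ lies in `dcl L B` with `#B < κ`. Inequalities
between values are countable conjunctions of formulas n|x| < |y|, so real residues and pseudo-limits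
are realizations of types over few parameters. For G, quantifier elimination for divisible ordered
groups (`signDetermined_realize`) reduces types to cuts over v(`dcl L E`) for a small E, and these
lift to types of M (`exists_value_cut_of_isSaturated`). -/

namespace OMinSat

/-! ### Definable sets and the definable closure operator. -/

section Definability

open FirstOrder.Language Set

variable {L : FirstOrder.Language.{u, v}} {M : Type w} [L.Structure M] {A B : Set M} {n : ℕ}

theorem definable_exists {R : (Fin n → M) → M → Prop}
    (h : A.Definable L {w : Fin (n + 1) → M | R (fun i => w i.castSucc) (w (Fin.last n))}) :
    A.Definable L {v : Fin n → M | ∃ x, R v x} := by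
  convert h.image_comp Fin.castSucc using 1
  ext v
  constructor
  · rintro ⟨x, hx⟩
    refine ⟨Fin.snoc v x, ?_, ?_⟩
    · simpa using hx
    · ext i; simp
  · rintro ⟨w, hw, rfl⟩
    exact ⟨w (Fin.last n), hw⟩

theorem definable_not {α : Type*} {p : (α → M) → Prop} (h : A.Definable L {v | p v}) :
    A.Definable L {v | ¬ p v} := h.compl

theorem definable_and {α : Type*} {p q : (α → M) → Prop} (hp : A.Definable L {v | p v})
    (hq : A.Definable L {v | q v}) : A.Definable L {v | p v ∧ q v} := hp.inter hq

theorem definable_imp {α : Type*} {p q : (α → M) → Prop} (hp : A.Definable L {v | p v})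
    (hq : A.Definable L {v | q v}) : A.Definable L {v | p v → q v} := by
  convert hp.compl.union hq using 1
  ext v
  simp [imp_iff_not_or]

theorem definable_forall {R : (Fin n → M) → M → Prop}
    (h : A.Definable L {w : Fin (n + 1) → M | R (fun i => w i.castSucc) (w (Fin.last n))}) :
    A.Definable L {v : Fin n → M | ∀ x, R v x} := by
  convert definable_not (definable_exists (R := fun v x => ¬ R v x) (definable_not h)) using 1
  ext v
  simp

theorem definable_mem {α : Type*} {S : Set M} (hS : A.Definable₁ L S) {f : (α → M) → M}
    (hf : A.DefinableFun L f) : A.Definable L {v | f v ∈ S} :=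
  Set.Definable.preimage_map (F := fun v _ => f v) (fun _ => hf) hS

theorem definable_mem₂ {α : Type*} {S : Set (M × M)} (hS : A.Definable₂ L S) {f g : (α → M) → M}
    (hf : A.DefinableFun L f) (hg : A.DefinableFun L g) :
    A.Definable L {v | (f v, g v) ∈ S} := by
  refine Set.Definable.preimage_map (F := fun v => ![f v, g v]) (fun i => ?_) hS
  fin_cases i
  · exact hf
  · exact hg

theorem definable_relMap {α : Type*} (r : L.Relations 2) {f g : (α → M) → M}
    (hf : A.DefinableFun L f) (hg : A.DefinableFun L g) :
    A.Definable L {v | FirstOrder.Language.Structure.RelMap r ![f v, g v]} := by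
  have h : (∅ : Set M).Definable L {x : Fin 2 → M | FirstOrder.Language.Structure.RelMap r x} := by
    rw [Set.empty_definable_iff]
    refine ⟨r.formula fun i => Term.var i, ?_⟩
    ext x
    simp [Formula.realize_rel]
  refine Set.Definable.preimage_map (F := fun v => ![f v, g v]) (fun i => ?_)
    (h.mono (empty_subset A))
  fin_cases i
  · exact hf
  · exact hg

theorem definableFun_funMap {α : Type*} (r : L.Functions 2) {f g : (α → M) → M}
    (hf : A.DefinableFun L f) (hg : A.DefinableFun L g) :
    A.DefinableFun L fun v => FirstOrder.Language.Structure.funMap r ![f v, g v] := by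
  refine Set.DefinableFun.comp (f := Structure.funMap r) (g := fun v => ![f v, g v]) (fun i => ?_)
    (Set.DefinableFun.of_empty (DefinableFun.fun_symbol r))
  fin_cases i
  · exact hf
  · exact hg

/-- Trades the parameter `a` for an extra variable, indexed by `Unit`, that is then specialized to
`a`. -/
theorem definable_insert_iff {α : Type*} {a : M} {s : Set (α → M)} :
    (insert a A).Definable L s ↔
      ∃ R : Set (α ⊕ Unit → M), A.Definable L R ∧ s = {v | Sum.elim v (fun _ => a) ∈ R} := by
  classical
  constructor
  · intro h
    obtain ⟨φ, rfl⟩ := definable_iff_exists_formula_sum.1 h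
    let g : (↥(insert a A)) ⊕ α → A ⊕ (α ⊕ Unit) :=
      Sum.elim (fun c => if hc : c.1 ∈ A then Sum.inl ⟨c.1, hc⟩ else Sum.inr (Sum.inr ()))
        (fun i => Sum.inr (Sum.inl i))
    refine ⟨{v | (φ.relabel g).Realize (Sum.elim (↑) v)},
      definable_iff_exists_formula_sum.2 ⟨φ.relabel g, rfl⟩, ?_⟩
    ext v
    simp only [Formula.realize_relabel, mem_ofPred_eq]
    apply iff_of_eq
    congr 1
    ext i
    rcases i with ⟨c, hc⟩ | i
    · by_cases hcA : c ∈ A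
      · simp [g, hcA]
      · obtain rfl := (mem_insert_iff.1 hc).resolve_right hcA
        simp [g, hcA]
    · simp [g]
  · rintro ⟨R, hR, rfl⟩
    obtain ⟨φ, rfl⟩ := definable_iff_exists_formula_sum.1 hR
    let g : A ⊕ (α ⊕ Unit) → (↥(insert a A)) ⊕ α :=
      Sum.elim (fun c => Sum.inl ⟨c.1, mem_insert_of_mem _ c.2⟩)
        (Sum.elim Sum.inr fun _ => Sum.inl ⟨a, mem_insert _ _⟩)
    refine definable_iff_exists_formula_sum.2 ⟨φ.relabel g, ?_⟩
    ext v
    simp only [Formula.realize_relabel, mem_ofPred_eq]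
    apply iff_of_eq
    congr 1
    ext i
    rcases i with c | i | i <;> simp [g]

theorem dcl_mono (h : A ⊆ B) : dcl L A ⊆ dcl L B := fun _ ha => Set.Definable.mono ha h

theorem subset_dcl : A ⊆ dcl L A := fun _ ha => Definable.singleton_of_mem L ha

/-- The parameter `a` can be quantified away: it is the only value of the extra variable lying in
the `A`-definable set `{a}`. -/
theorem definable_of_insert {α : Type*} {a : M} (ha : a ∈ dcl L A) {s : Set (α → M)}
    (h : (insert a A).Definable L s) : A.Definable L s := by
  obtain ⟨R, hR, rfl⟩ := definable_insert_iff.1 h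
  have h1 : A.Definable L {x : α ⊕ Unit → M | x (Sum.inr ()) ∈ ({a} : Set M)} :=
    definable_mem ha (DefinableFun.proj L)
  convert Definable.exists_of_finite (h1.inter hR) using 1
  ext v
  constructor
  · intro hv
    exact ⟨fun _ => a, by simp, hv⟩
  · rintro ⟨w, hw1, hw2⟩
    have : w = fun _ => a := funext fun _ => by simpa using hw1
    rwa [this] at hw2

/-- A formula uses finitely many parameters, and those from `dcl L A` are eliminated one at a time.
-/
theorem definable_of_dcl {α : Type*} {s : Set (α → M)} (h : (dcl L A).Definable L s) :
    A.Definable L s := by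
  classical
  obtain ⟨C, hC, hs⟩ := definable_iff_finitely_definable.1 h
  replace hs : (A ∪ (C : Set M)).Definable L s := hs.mono subset_union_right
  clear h
  induction C using Finset.induction_on with
  | empty => simpa using hs
  | insert c C _ ih =>
    refine ih (fun x hx => hC (by simp at hx ⊢; exact Or.inr hx)) (definable_of_insert (a := c) ?_ ?_)
    · exact dcl_mono subset_union_left (hC (by simp))
    · simpa [Set.union_insert] using hs

theorem dcl_dcl : dcl L (dcl L A) = dcl L A :=
  Subset.antisymm (fun _ ha => definable_of_dcl ha) subset_dcl

theorem dcl_subset (h : A ⊆ dcl L B) : dcl L A ⊆ dcl L B := (dcl_mono h).trans dcl_dcl.subset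

/-- Lets a basis over the prime model be treated as a plain generating set. -/
theorem dcl_primeModel_union : dcl L (primeModel L M ∪ A) = dcl L A :=
  Subset.antisymm (dcl_subset (union_subset (dcl_mono (empty_subset A)) subset_dcl))
    (dcl_mono subset_union_right)

theorem exists_finset_of_mem_dcl {a : M} (h : a ∈ dcl L A) :
    ∃ C : Finset M, (C : Set M) ⊆ A ∧ a ∈ dcl L (C : Set M) :=
  definable_iff_finitely_definable.1 h

/-- An element given by a definable function of elements of `dcl A` is in `dcl A`. -/
theorem mem_dcl_of_definable {a : M} (h : (dcl L A).Definable₁ L ({a} : Set M)) : a ∈ dcl L A :=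
  definable_of_dcl h

theorem funMap_mem_dcl {m : ℕ} (f : L.Functions m) {x : Fin m → M} (hx : ∀ i, x i ∈ dcl L A) :
    FirstOrder.Language.Structure.funMap f x ∈ dcl L A := by
  apply mem_dcl_of_definable
  have h : (dcl L A).DefinableFun L fun _ : Fin 1 → M => Structure.funMap f x :=
    Set.DefinableFun.comp (f := Structure.funMap f) (g := fun _ => x)
      (fun i => L.definableFun_const _ (hx i))
      (Set.DefinableFun.of_empty (DefinableFun.fun_symbol f))
  exact (DefinableFun.proj L).ofPred_eq h

variable (L) in
/-- The definable closure as a substructure. -/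
def dclSubstructure (A : Set M) : L.Substructure M where
  carrier := dcl L A
  fun_mem f _ hx := funMap_mem_dcl f hx

end Definability

/-! ### O-minimality: cuts, exchange, and bases. -/

section OMinimality

open FirstOrder.Language Set

variable {L : FirstOrder.Language.{u, v}} {M : Type w} [L.Structure M] {A B : Set M}

section Order

variable [LinearOrder M]

/-- Membership in `S` is constant on some open interval around `a`. -/
def LocConst (S : Set M) (a : M) : Prop :=
  ∃ u w, u < a ∧ a < w ∧ ∀ s, u < s → s < w → ∀ t, u < t → t < w → s ∈ S → t ∈ S

/-- Membership in `S` only depends on the position with respect to the points of `F`. -/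
def DeterminedBy (F : Finset M) (S : Set M) : Prop :=
  ∀ s t, (∀ f ∈ F, (f < s ↔ f < t) ∧ (s < f ↔ t < f)) → s ∈ S → t ∈ S

theorem LocConst.compl {S : Set M} {a : M} (h : LocConst S a) : LocConst Sᶜ a := by
  obtain ⟨u, w, hu, hw, h⟩ := h
  exact ⟨u, w, hu, hw, fun s h1 h2 t h3 h4 hs ht => hs (h t h3 h4 s h1 h2 ht)⟩

theorem LocConst.union {S T : Set M} {a : M} (hS : LocConst S a) (hT : LocConst T a) :
    LocConst (S ∪ T) a := by
  obtain ⟨u, w, hu, hw, h⟩ := hS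
  obtain ⟨u', w', hu', hw', h'⟩ := hT
  refine ⟨max u u', min w w', max_lt hu hu', lt_min hw hw', fun s h1 h2 t h3 h4 => ?_⟩
  rw [max_lt_iff] at h1 h3
  rw [lt_min_iff] at h2 h4
  exact Or.imp (h s h1.1 h2.1 t h3.1 h4.1) (h' s h1.2 h2.2 t h3.2 h4.2)

theorem LocConst.inter {S T : Set M} {a : M} (hS : LocConst S a) (hT : LocConst T a) :
    LocConst (S ∩ T) a := by
  have := (hS.compl.union hT.compl).compl
  rwa [compl_union, compl_compl, compl_compl] at this

variable [NoMinOrder M] [NoMaxOrder M]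

theorem locConst_univ (a : M) : LocConst univ a := by
  obtain ⟨u, hu⟩ := exists_lt a
  obtain ⟨w, hw⟩ := exists_gt a
  exact ⟨u, w, hu, hw, fun _ _ _ _ _ _ _ => trivial⟩

theorem locConst_Iio {a b : M} (h : a ≠ b) : LocConst (Iio b) a := by
  obtain ⟨u, hu⟩ := exists_lt a
  obtain ⟨w, hw⟩ := exists_gt a
  rcases h.lt_or_gt with h | h
  · exact ⟨u, b, hu, h, fun _ _ _ _ _ h _ => h⟩
  · exact ⟨b, w, h, hw, fun _ h _ _ _ _ h' => absurd h' h.not_gt⟩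

theorem locConst_Ioi {a b : M} (h : a ≠ b) : LocConst (Ioi b) a := by
  obtain ⟨u, hu⟩ := exists_lt a
  obtain ⟨w, hw⟩ := exists_gt a
  rcases h.lt_or_gt with h | h
  · exact ⟨u, b, hu, h, fun _ _ h _ _ _ h' => absurd h' h.not_gt⟩
  · exact ⟨b, w, h, hw, fun _ _ _ _ h _ _ => h⟩

theorem IsPointOrOpenInterval.finite_not_locConst {I : Set M} (hI : IsPointOrOpenInterval I) :
    {a | ¬ LocConst I a}.Finite := by
  rcases hI with ⟨a, rfl⟩ | ⟨a, b, rfl⟩ | ⟨a, rfl⟩ | ⟨a, rfl⟩ | rfl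
  · refine (finite_singleton a).subset fun c hc => ?_
    by_contra h
    apply hc
    have := ((locConst_Iio h).union (locConst_Ioi h)).compl
    convert this
    ext x
    simp [le_antisymm_iff, and_comm]
  · refine ((finite_singleton b).insert a).subset fun c hc => ?_
    by_contra h
    simp only [mem_insert_iff, mem_singleton_iff, not_or] at h
    exact hc ((locConst_Ioi h.1).inter (locConst_Iio h.2))
  · refine (finite_singleton a).subset fun c hc => ?_
    by_contra h
    exact hc (locConst_Iio h)
  · refine (finite_singleton a).subset fun c hc => ?_
    by_contra h
    exact hc (locConst_Ioi h)
  · convert finite_empty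
    ext a
    simp [locConst_univ]

theorem finite_not_locConst_sUnion {F : Set (Set M)} (hF : F.Finite)
    (h : ∀ I ∈ F, IsPointOrOpenInterval I) : {a | ¬ LocConst (⋃₀ F) a}.Finite := by
  induction F, hF using Set.Finite.induction_on with
  | empty =>
    convert finite_empty
    ext a
    simpa using (locConst_univ a).compl
  | @insert I F _ _ ih =>
    refine ((h I (mem_insert _ _)).finite_not_locConst.union
      (ih fun J hJ => h J (mem_insert_of_mem _ hJ))).subset fun a ha => ?_
    by_contra hc
    simp only [mem_union, mem_ofPred_eq, not_or, not_not] at hc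
    rw [mem_ofPred_eq, sUnion_insert] at ha
    exact ha (hc.1.union hc.2)

omit [NoMinOrder M] in
-- The substitute for completeness: each nonempty bounded piece has its endpoint as supremum, and
-- suprema of finitely many pieces combine.
theorem exists_isLUB_sUnion [DenselyOrdered M] {F : Set (Set M)} (hF : F.Finite)
    (h : ∀ I ∈ F, IsPointOrOpenInterval I) (hne : (⋃₀ F).Nonempty) (hb : BddAbove (⋃₀ F)) :
    ∃ c, IsLUB (⋃₀ F) c := by
  induction F, hF using Set.Finite.induction_on with
  | empty => simp at hne
  | @insert I F _ _ ih =>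
    rw [sUnion_insert] at hne hb ⊢
    have ih := ih (fun J hJ => h J (mem_insert_of_mem _ hJ))
    have hbI := hb.mono subset_union_left
    have hI : I.Nonempty → ∃ c, IsLUB I c := by
      intro hne
      rcases h I (mem_insert _ _) with ⟨a, rfl⟩ | ⟨a, b, rfl⟩ | ⟨a, rfl⟩ | ⟨a, rfl⟩ | rfl
      · exact ⟨a, isLUB_singleton⟩
      · exact ⟨b, isLUB_Ioo (nonempty_Ioo.1 hne)⟩
      · exact ⟨a, isLUB_Iio⟩
      · exact absurd hbI (not_bddAbove_Ioi a)
      · have : Nonempty M := hne.nonempty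
        exact absurd hbI not_bddAbove_univ
    rcases I.eq_empty_or_nonempty with rfl | hI'
    · simpa using ih (by simpa using hne) (by simpa using hb)
    · obtain ⟨c, hc⟩ := hI hI'
      rcases (⋃₀ F).eq_empty_or_nonempty with hF | hF
      · exact ⟨c, by simpa [hF] using hc⟩
      · obtain ⟨d, hd⟩ := ih hF (hb.mono subset_union_right)
        exact ⟨_, hc.union hd⟩

end Order

variable [LinearOrder M]
  (hlt : ∃ r : L.Relations 2, ∀ x : Fin 2 → M, Structure.RelMap r x ↔ x 0 < x 1)

include hlt in
theorem definable_lt {α : Type*} {f g : (α → M) → M}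
    (hf : A.DefinableFun L f) (hg : A.DefinableFun L g) : A.Definable L {v | f v < g v} := by
  obtain ⟨r, hr⟩ := hlt
  convert definable_relMap r hf hg using 1
  ext v
  simp [hr]

include hlt in
theorem definable_Iio {a : M} (ha : a ∈ A) : A.Definable₁ L (Iio a) :=
  definable_lt hlt (DefinableFun.proj L) (L.definableFun_const _ ha)

include hlt in
theorem definable_Ioi {a : M} (ha : a ∈ A) : A.Definable₁ L (Ioi a) :=
  definable_lt hlt (L.definableFun_const _ ha) (DefinableFun.proj L)

include hlt in
theorem definable_locConst {n : ℕ} {R : (Fin n → M) → M → Prop} {f : (Fin n → M) → M}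
    (hf : A.DefinableFun L f)
    (hR : A.Definable L {w : Fin (n + 1) → M | R (fun i => w i.castSucc) (w (Fin.last n))}) :
    A.Definable L {v | LocConst {x | R v x} (f v)} := by
  unfold LocConst
  have hf' : A.DefinableFun L (fun v : Fin (n + 1 + 1) → M => f fun i => v i.castSucc.castSucc) :=
    DefinableFun.comp (fun i => DefinableFun.proj L) hf
  have hR' : ∀ k : Fin (n + 1 + 1 + 1 + 1), A.Definable L
      {v : Fin (n + 1 + 1 + 1 + 1) → M |
        R (fun i => v i.castSucc.castSucc.castSucc.castSucc) (v k)} := by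
    intro k
    convert hR.preimage_comp (Fin.snoc (α := fun _ => Fin (n + 1 + 1 + 1 + 1))
      (fun i : Fin n => i.castSucc.castSucc.castSucc.castSucc) k) using 1
    ext v
    simp
  refine definable_exists (definable_exists (definable_and (definable_lt hlt ?_ hf')
    (definable_and (definable_lt hlt hf' ?_) (definable_forall (definable_imp
    (definable_lt hlt ?_ ?_) (definable_imp (definable_lt hlt ?_ ?_) (definable_forall
    (definable_imp (definable_lt hlt ?_ ?_) (definable_imp (definable_lt hlt ?_ ?_)
    (definable_imp (hR' _) (hR' _)))))))))))
  all_goals exact DefinableFun.proj L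

include hlt in
/-- A finite definable set consists of definable elements. -/
theorem subset_dcl_of_finite {F : Set M} (hF : F.Finite) (hd : A.Definable₁ L F) :
    F ⊆ dcl L A := by
  induction hn : F.ncard generalizing F with
  | zero =>
    rw [(ncard_eq_zero hF).1 hn]
    exact empty_subset _
  | succ n ih =>
    have hne : F.Nonempty := by
      rw [← ncard_pos hF, hn]; omega
    -- The least element of `F` is definable from `F` by means of the order; remove it and induct on
    -- the cardinality.
    obtain ⟨m, hm, hmin⟩ := exists_min_image F id hF hne
    have hmd : m ∈ dcl L A := by
      have : A.Definable L {v : Fin 1 → M | v 0 ∈ F ∧ ∀ y, y ∈ F → ¬ y < v 0} :=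
        definable_and (definable_mem hd (DefinableFun.proj L))
          (definable_forall (definable_imp (definable_mem hd (DefinableFun.proj L))
            (definable_not (definable_lt hlt (DefinableFun.proj L) (DefinableFun.proj L)))))
      refine (congrArg (A.Definable L) (Set.ext fun v => ?_)).mp this
      simp only [mem_singleton_iff, mem_ofPred_eq, not_lt]
      symm
      constructor
      · rintro h
        exact ⟨h ▸ hm, h ▸ hmin⟩
      · rintro ⟨h1, h2⟩
        exact le_antisymm (h2 _ hm) (hmin _ h1)
    have hsub := ih (F := F \ {m}) (hF.subset sdiff_subset)
      (definable_and (definable_mem hd (DefinableFun.proj L))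
        (definable_not (definable_mem hmd (DefinableFun.proj L))))
      (by rw [ncard_sdiff_singleton_of_mem hm, hn]; rfl)
    intro x hx
    by_cases h : x = m
    · exact h ▸ hmd
    · exact hsub ⟨hx, h⟩

omit [LinearOrder M] in
theorem exists_definable₂_of_insert {a : M} {S : Set M} (h : (insert a A).Definable₁ L S) :
    ∃ F : Set (M × M), A.Definable₂ L F ∧ S = {y | (a, y) ∈ F} := by
  obtain ⟨R, hR, hS⟩ := definable_insert_iff.1 h
  refine ⟨{p | Sum.elim (fun _ => p.2) (fun _ => p.1) ∈ R}, ?_, ?_⟩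
  · refine (congrArg (A.Definable L) (Set.ext fun v => ?_)).mp
      (hR.preimage_comp (Sum.elim (fun _ => 1) (fun _ => 0) : Fin 1 ⊕ Unit → Fin 2))
    simp only [mem_ofPred_eq, mem_preimage]
    apply iff_of_eq
    congr 1
    ext i
    rcases i with i | i <;> rfl
  · ext y
    have := congrArg (fun T => (fun _ : Fin 1 => y) ∈ T) hS
    simpa using this

variable [DenselyOrdered M] [NoMinOrder M] [NoMaxOrder M] (homin : IsOMinimal L M)

omit [NoMinOrder M] in
include hlt homin in
-- A connectedness argument: local constancy at the supremum of `S` ∩ [s, t] pushes `S` past that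
-- supremum unless it is already `t`.
theorem mem_of_mem_of_locConst {S : Set M} (hS : (univ : Set M).Definable₁ L S) {s t : M}
    (hst : s ≤ t) (h : ∀ c, s ≤ c → c ≤ t → LocConst S c) (hs : s ∈ S) : t ∈ S := by
  by_contra ht
  have hT : (univ : Set M).Definable₁ L {x | x ∈ S ∧ ¬ x < s ∧ ¬ t < x} :=
    definable_and (definable_mem hS (DefinableFun.proj L)) (definable_and
      (definable_not (definable_lt hlt (DefinableFun.proj L) (L.definableFun_const _ (mem_univ _))))
      (definable_not (definable_lt hlt (L.definableFun_const _ (mem_univ _))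
        (DefinableFun.proj L))))
  set T : Set M := {x | x ∈ S ∧ ¬ x < s ∧ ¬ t < x} with hTdef
  obtain ⟨F, hF, hI, hFT⟩ := homin _ hT
  have hsT : s ∈ T := ⟨hs, lt_irrefl _, hst.not_gt⟩
  obtain ⟨c, hc⟩ : ∃ c, IsLUB T c := by
    rw [hFT]
    exact exists_isLUB_sUnion hF hI (hFT ▸ ⟨s, hsT⟩) (hFT ▸ ⟨t, fun x hx => not_lt.1 hx.2.2⟩)
  have hsc : s ≤ c := hc.1 hsT
  have hct : c ≤ t := hc.2 fun x hx => not_lt.1 hx.2.2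
  obtain ⟨u, w, hu, hw, hloc⟩ := h c hsc hct
  obtain ⟨z, hz, huz, hzc⟩ := hc.exists_between hu
  rcases hct.eq_or_lt with rfl | hct
  · exact ht (hloc z huz (hzc.trans_lt hw) c hu hw hz.1)
  · obtain ⟨y, hcy, hy⟩ := exists_between (lt_min hw hct)
    rw [lt_min_iff] at hy
    have hyS := hloc z huz (hzc.trans_lt hw) y (hu.trans hcy) hy.1 hz.1
    exact hcy.not_ge (hc.1 ⟨hyS, (hsc.trans hcy.le).not_gt, hy.2.le.not_gt⟩)

omit [NoMinOrder M] in
include hlt homin in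
/-- A definable set that is locally constant on a closed interval is constant on it. -/
theorem mem_iff_of_locConst {S : Set M} (hS : (univ : Set M).Definable₁ L S) {s t : M}
    (hst : s ≤ t) (h : ∀ c, s ≤ c → c ≤ t → LocConst S c) : s ∈ S ↔ t ∈ S := by
  refine ⟨mem_of_mem_of_locConst hlt homin hS hst h, fun ht => ?_⟩
  by_contra hs
  exact mem_of_mem_of_locConst hlt homin (S := Sᶜ) (definable_not hS) hst
    (fun c h1 h2 => (h c h1 h2).compl) hs ht

omit [DenselyOrdered M] in
include homin in
theorem finite_not_locConst {S : Set M} (hS : A.Definable₁ L S) : {a | ¬ LocConst S a}.Finite := by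
  obtain ⟨F, hF, hI, rfl⟩ := homin S (hS.mono (subset_univ A))
  exact finite_not_locConst_sUnion hF hI

omit [DenselyOrdered M] in
include hlt homin in
-- The boundary points of `S` form a finite set that is itself definable over `A`.
theorem mem_dcl_of_not_locConst {S : Set M} (hS : A.Definable₁ L S) {a : M}
    (ha : ¬ LocConst S a) : a ∈ dcl L A := by
  refine subset_dcl_of_finite hlt (finite_not_locConst homin hS) ?_ ha
  exact definable_not (definable_locConst hlt (R := fun _ x => x ∈ S) (DefinableFun.proj L)
    (definable_mem hS (DefinableFun.proj L)))

include hlt homin in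
/-- A set definable over `A` is cut out by finitely many points of `dcl A`. -/
theorem exists_determinedBy {S : Set M} (hS : A.Definable₁ L S) :
    ∃ F : Finset M, (F : Set M) ⊆ dcl L A ∧ DeterminedBy F S := by
  refine ⟨(finite_not_locConst homin hS).toFinset, fun a ha => ?_, fun s t h hs => ?_⟩
  · exact mem_dcl_of_not_locConst hlt homin hS (by simpa using ha)
  · simp only [Finite.mem_toFinset, mem_ofPred_eq] at h
    by_cases hne : s = t
    · exact hne ▸ hs
    have hS' : (univ : Set M).Definable₁ L S := hS.mono (subset_univ _)
    have key : ∀ c, ¬ LocConst S c → ¬ (s ≤ c ∧ c ≤ t) ∧ ¬ (t ≤ c ∧ c ≤ s) := by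
      intro c hc
      have := h c hc
      grind
    rcases le_total s t with hst | hst
    · exact (mem_iff_of_locConst hlt homin hS' hst
        fun c h1 h2 => by_contra fun hc => (key c hc).1 ⟨h1, h2⟩).1 hs
    · exact (mem_iff_of_locConst hlt homin hS' hst
        fun c h1 h2 => by_contra fun hc => (key c hc).2 ⟨h1, h2⟩).2 hs

omit [LinearOrder M] [DenselyOrdered M] [NoMinOrder M] [NoMaxOrder M] in
theorem definable_insert_section {F : Set (M × M)} (hF : A.Definable₂ L F) (b : M) :
    (insert b A).Definable₁ L {x | (x, b) ∈ F} :=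
  definable_mem₂ (hF.mono (subset_insert b A)) (DefinableFun.proj L)
    (L.definableFun_const _ (mem_insert b A))

omit [NoMinOrder M] in
include hlt homin in
/-- In a definable family of disjoint sets, only finitely many sets have interior. -/
theorem finite_interior_nonempty {F : Set (M × M)} (hF : A.Definable₂ L F)
    (hdisj : ∀ x y z, (x, y) ∈ F → (x, z) ∈ F → y = z) :
    {y | ∃ x, (x, y) ∈ F ∧ LocConst {x | (x, y) ∈ F} x}.Finite := by
  have hint : (univ : Set M).Definable₂ L
      {p | p ∈ F ∧ LocConst {x | (x, p.2) ∈ F} p.1} := by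
    have hF' := hF.mono (subset_univ A)
    exact definable_and (definable_mem₂ hF' (DefinableFun.proj L) (DefinableFun.proj L))
      (definable_locConst hlt (R := fun v x => (x, v 1) ∈ F) (DefinableFun.proj L)
        (definable_mem₂ hF' (DefinableFun.proj L) (DefinableFun.proj L)))
  -- The union of the interiors of all fibres is definable, so it splits into finitely many convex
  -- pieces. It suffices that each piece meets the interior of only one fibre.
  obtain ⟨P, hP, hI, hWP⟩ := homin {x | ∃ y, (x, y) ∈ F ∧ LocConst {x | (x, y) ∈ F} x}
    (definable_exists (definable_mem₂ hint (DefinableFun.proj L) (DefinableFun.proj L)))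
  have hsub : {y | ∃ x, (x, y) ∈ F ∧ LocConst {x | (x, y) ∈ F} x} ⊆
      ⋃ I ∈ P, {y | ∃ x ∈ I, (x, y) ∈ F ∧ LocConst {x | (x, y) ∈ F} x} := by
    rintro y ⟨x, hx⟩
    have : x ∈ ⋃₀ P := hWP ▸ ⟨y, hx⟩
    obtain ⟨I, hI, hxI⟩ := this
    exact mem_biUnion hI ⟨x, hxI, hx⟩
  refine (hP.biUnion fun I hIP => Set.Subsingleton.finite ?_).subset hsub
  have hconv : I.OrdConnected := by
    rcases hI I hIP with ⟨a, rfl⟩ | ⟨a, b, rfl⟩ | ⟨a, rfl⟩ | ⟨a, rfl⟩ | rfl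
    · exact ordConnected_singleton
    · exact ordConnected_Ioo
    · exact ordConnected_Iio
    · exact ordConnected_Ioi
    · exact ordConnected_univ
  have hIW : I ⊆ {x | ∃ y, (x, y) ∈ F ∧ LocConst {x | (x, y) ∈ F} x} :=
    hWP ▸ subset_sUnion_of_mem hIP
  -- Around each point of `I` some single fibre fills an interval, and disjointness excludes the
  -- others there. Lying in the interior of the fibre of `y` is therefore locally constant on `I`.
  have key : ∀ y, ∀ c ∈ I, LocConst {x | (x, y) ∈ F ∧ LocConst {x | (x, y) ∈ F} x} c := by
    intro y c hc
    obtain ⟨z, hz, hloc⟩ := hIW hc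
    obtain ⟨u, w, hu, hw, h⟩ := hloc
    refine ⟨u, w, hu, hw, fun s hus hsw t hut htw hs => ?_⟩
    obtain rfl : z = y := hdisj s z y (h c hu hw s hus hsw hz) hs.1
    exact ⟨h c hu hw t hut htw hz, u, w, hut, htw, h⟩
  rintro y ⟨x, hx, hy⟩ y' ⟨x', hx', hy'⟩
  have hdef : ∀ y, (univ : Set M).Definable₁ L
      {x | (x, y) ∈ F ∧ LocConst {x | (x, y) ∈ F} x} := fun y =>
    definable_mem₂ hint (DefinableFun.proj L) (L.definableFun_const _ (mem_univ y))
  rcases le_total x x' with h | h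
  · have := (mem_iff_of_locConst hlt homin (hdef y) h
      fun c h1 h2 => key y c (hconv.out hx hx' ⟨h1, h2⟩)).1 hy
    exact hdisj _ _ _ this.1 hy'.1
  · have := (mem_iff_of_locConst hlt homin (hdef y) h
      fun c h1 h2 => key y c (hconv.out hx' hx ⟨h1, h2⟩)).2 hy
    exact hdisj _ _ _ this.1 hy'.1

include hlt homin in
/-- The exchange property of the definable closure in an o-minimal structure. -/
theorem dcl_exchange {a b : M} (hb : b ∈ dcl L (insert a A)) (hb' : b ∉ dcl L A) :
    a ∈ dcl L (insert b A) := by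
  obtain ⟨G, hG, hab⟩ := exists_definable₂_of_insert hb
  have hF : A.Definable₂ L {p | p ∈ G ∧ ∀ z, (p.1, z) ∈ G → z = p.2} :=
    definable_and (definable_mem₂ hG (DefinableFun.proj L) (DefinableFun.proj L))
      (definable_forall (definable_imp
        (definable_mem₂ hG (DefinableFun.proj L) (DefinableFun.proj L))
        ((DefinableFun.proj L).ofPred_eq (DefinableFun.proj L))))
  -- Cuts `G` down to the graph of a partial function that still sends `a` to `b`, so that its
  -- fibres over second coordinates are disjoint.
  set F : Set (M × M) := {p | p ∈ G ∧ ∀ z, (p.1, z) ∈ G → z = p.2} with hFdef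
  have habF : (a, b) ∈ F := by
    have h : ∀ z, z = b ↔ (a, z) ∈ G := fun z => Set.ext_iff.1 hab z
    exact ⟨(h b).1 rfl, fun z hz => (h z).2 hz⟩
  by_contra ha
  -- If `a` were not in the closure of `A` and `b`, it would be an interior point of the fibre over
  -- `b`. Then `b` would belong to a finite `A`-definable set.
  refine hb' (subset_dcl_of_finite hlt (finite_interior_nonempty hlt homin hF ?_) ?_ ⟨a, habF, ?_⟩)
  · exact fun x y z hy hz => hz.2 y hy.1
  · exact definable_exists (definable_and
      (definable_mem₂ hF (DefinableFun.proj L) (DefinableFun.proj L))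
      (definable_locConst hlt (R := fun v x => (x, v 0) ∈ F) (DefinableFun.proj L)
        (definable_mem₂ hF (DefinableFun.proj L) (DefinableFun.proj L))))
  · by_contra h
    exact ha (mem_dcl_of_not_locConst hlt homin (definable_insert_section hF b) h)

include hlt homin in
/-- Every set contains a basis of its definable closure over the prime model. -/
theorem exists_subset_basis (A : Set M) :
    ∃ B ⊆ A, IsBasisOver L (primeModel L M) (dcl L A) B := by
  obtain ⟨B, hB⟩ := zorn_subset {B | B ⊆ A ∧ IsIndepOver L (primeModel L M) B} (by
    intro c hc hchain
    refine ⟨⋃₀ c, ⟨sUnion_subset fun B hB => (hc hB).1, fun b hb hb' => ?_⟩,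
      fun B hB => subset_sUnion_of_mem hB⟩
    rw [dcl_primeModel_union] at hb'
    obtain ⟨C, hC, hbC⟩ := exists_finset_of_mem_dcl hb'
    obtain ⟨B₀, hB₀, hbB₀⟩ := hb
    have : ∃ B ∈ c, insert b (C : Set M) ⊆ B := by
      have hfin : (insert b (C : Set M)).Finite := C.finite_toSet.insert b
      refine DirectedOn.exists_mem_subset_of_finite_of_subset_sUnion ⟨B₀, hB₀⟩ hchain.directedOn hfin
        (insert_subset ⟨B₀, hB₀, hbB₀⟩ fun x hx => (hC hx).1)
    obtain ⟨B, hBc, hCB⟩ := this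
    refine (hc hBc).2 b (hCB (mem_insert _ _)) (dcl_mono ?_ hbC)
    exact fun x hx => Or.inr ⟨hCB (mem_insert_of_mem _ hx), (hC hx).2⟩)
  have hBA : B ⊆ A := hB.prop.1
  have hind : IsIndepOver L (primeModel L M) B := hB.prop.2
  refine ⟨B, hBA, hBA.trans subset_dcl, hind, ?_⟩
  rw [dcl_primeModel_union]
  refine dcl_subset fun a ha => ?_
  by_contra haB
  have haB' : a ∉ B := fun h => haB (subset_dcl h)
  refine haB' (hB.le_of_ge (y := insert a B) ⟨insert_subset ha hBA, ?_⟩ (subset_insert a B)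
    (mem_insert a B))
  rintro b hb hbd
  rw [dcl_primeModel_union] at hbd
  rcases eq_or_ne b a with rfl | hne
  · rw [insert_sdiff_of_mem _ (mem_singleton b), sdiff_singleton_eq_self haB'] at hbd
    exact haB hbd
  · have hbB : b ∈ B := hb.resolve_left hne
    rw [insert_sdiff_of_notMem _ (by simpa using hne.symm)] at hbd
    have h1 := hind b hbB
    rw [dcl_primeModel_union] at h1
    -- Exchange turns a dependence of `b` on the new element `a` into a dependence of `a` on `B`.
    have h2 := dcl_exchange hlt homin hbd h1
    rw [insert_sdiff_singleton, insert_eq_of_mem hbB] at h2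
    exact haB h2

end OMinimality

/-! ### Quantifier elimination for divisible ordered abelian groups. -/

section DivisibleGroups

open FirstOrder.Language Set

variable {V : Type w} [AddCommGroup V] [LinearOrder V] [IsOrderedAddMonoid V]

theorem sign_zsmul_eq_mul (c : ℤ) (a : V) :
    SignType.sign (c • a) = SignType.sign c * SignType.sign a := by
  rcases lt_trichotomy c 0 with hc | rfl | hc
  · have hc' : 0 < -c := by omega
    rcases lt_trichotomy a 0 with ha | rfl | ha
    · have : 0 < c • a := by
        have := zsmul_pos (neg_pos.2 ha) hc'
        simpa using this
      rw [sign_pos this, sign_neg hc, sign_neg ha]; rfl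
    · simp
    · have : c • a < 0 := by
        have := zsmul_pos ha hc'
        simpa using this
      rw [sign_neg this, sign_neg hc, sign_pos ha]; rfl
  · simp
  · rcases lt_trichotomy a 0 with ha | rfl | ha
    · have : c • a < 0 := by
        have := zsmul_pos (neg_pos.2 ha) hc
        simpa using this
      rw [sign_neg this, sign_pos hc, sign_neg ha]; rfl
    · simp
    · rw [sign_pos (zsmul_pos ha hc), sign_pos hc, sign_pos ha]; rfl

theorem sign_sub_eq_iff {a b a' b' : V} :
    SignType.sign (a - b) = SignType.sign (a' - b') ↔ (b < a ↔ b' < a') ∧ (a < b ↔ a' < b') := by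
  simp only [sign_apply, sub_pos, sub_neg]
  split_ifs <;> simp <;> grind

theorem denselyOrdered_of_divisible (hdiv : ∀ n : ℤ, n ≠ 0 → ∀ v : V, ∃ w, n • w = v) :
    DenselyOrdered V where
  dense a b hab := by
    obtain ⟨w, hw⟩ := hdiv 2 (by norm_num) (a + b)
    rw [two_zsmul] at hw
    refine ⟨w, ?_, ?_⟩
    · by_contra! h
      exact (add_le_add h h |>.trans_lt (add_lt_add_right hab a)).ne hw
    · by_contra! h
      exact ((add_lt_add_left hab b).trans_le (add_le_add h h)).ne' hw

variable [Nontrivial V] (hdiv : ∀ n : ℤ, n ≠ 0 → ∀ v : V, ∃ w, n • w = v)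

include hdiv in
/-- A finite family of one-variable affine functions realizes the same sign vectors as another one
with the same linear parts and the same order of zeros. -/
theorem exists_sign_eq {ι : Type*} [Finite ι] (c : ι → ℤ) (g g' : ι → V)
    (h0 : ∀ i, SignType.sign (g i) = SignType.sign (g' i))
    (h : ∀ i j, SignType.sign (c j • g i - c i • g j) = SignType.sign (c j • g' i - c i • g' j))
    (y : V) : ∃ y', ∀ i, SignType.sign (g i + c i • y) = SignType.sign (g' i + c i • y') := by
  classical
  have := denselyOrdered_of_divisible hdiv
  have := Fintype.ofFinite ι
  have hz : ∀ (g : ι → V) i, ∃ t, c i ≠ 0 → g i = -(c i • t) := fun g i => by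
    by_cases hc : c i = 0
    · exact ⟨0, fun h => absurd hc h⟩
    · obtain ⟨t, ht⟩ := hdiv (c i) hc (-g i)
      exact ⟨t, fun _ => by rw [ht, neg_neg]⟩
  choose t ht using hz g
  choose t' ht' using hz g'
  -- Since c_j g_i - c_i g_j = c_i c_j (t_j - t_i), its sign records the order of the zeros t_i and
  -- t_j.
  have hord : ∀ i j, c i ≠ 0 → c j ≠ 0 → (t i < t j ↔ t' i < t' j) ∧ (t j < t i ↔ t' j < t' i) := by
    intro i j hi hj
    have e : ∀ s : ι → V, c j • (-(c i • s i)) - c i • (-(c j • s j)) =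
        (c i * c j) • (s j - s i) := by
      intro s
      rw [smul_neg, smul_neg, smul_smul, smul_smul, smul_sub, mul_comm (c j)]
      abel
    have := h i j
    rw [ht i hi, ht j hj, ht' i hi, ht' j hj, e, e, sign_zsmul_eq_mul, sign_zsmul_eq_mul] at this
    have hne : SignType.sign (c i * c j) ≠ 0 := by simp [hi, hj]
    have cancel : ∀ a b c : SignType, a ≠ 0 → a * b = a * c → b = c := by decide
    exact sign_sub_eq_iff.1 (cancel _ _ _ hne this)
  suffices ∃ y', ∀ i, c i ≠ 0 → (t i < y ↔ t' i < y') ∧ (y < t i ↔ y' < t' i) by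
    obtain ⟨y', hy'⟩ := this
    refine ⟨y', fun i => ?_⟩
    by_cases hc : c i = 0
    · simpa [hc] using h0 i
    · have e : ∀ s z : V, -(c i • s) + c i • z = c i • (z - s) := by
        intro s z
        rw [smul_sub]; abel
      rw [ht i hc, ht' i hc, e, e, sign_zsmul_eq_mul, sign_zsmul_eq_mul, sign_sub_eq_iff.2 (hy' i hc)]
  -- Either `y` is itself a zero, and the matching zero serves, or it lies in a gap between zeros,
  -- and density supplies a point in the matching gap.
  by_cases hy : ∃ i, c i ≠ 0 ∧ t i = y
  · obtain ⟨j, hj, rfl⟩ := hy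
    exact ⟨t' j, fun i hi => hord i j hi hj⟩
  · push Not at hy
    obtain ⟨y', h1, h2⟩ := Order.exists_between_finsets
      ((Finset.univ.filter fun i => c i ≠ 0 ∧ t i < y).image t')
      ((Finset.univ.filter fun i => c i ≠ 0 ∧ y < t i).image t') (by
        intro a ha b hb
        simp only [Finset.mem_image, Finset.mem_filter, Finset.mem_univ, true_and] at ha hb
        obtain ⟨i, ⟨hi, hiy⟩, rfl⟩ := ha
        obtain ⟨j, ⟨hj, hjy⟩, rfl⟩ := hb
        exact (hord i j hi hj).1.1 (hiy.trans hjy))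
    simp only [Finset.mem_image, Finset.mem_filter, Finset.mem_univ, true_and] at h1 h2
    refine ⟨y', fun i hi => ?_⟩
    rcases (hy i hi).lt_or_gt with h | h
    · have := h1 _ ⟨i, ⟨hi, h⟩, rfl⟩
      simp [h, this, h.not_gt, this.not_gt]
    · have := h2 _ ⟨i, ⟨hi, h⟩, rfl⟩
      simp [h, this, h.not_gt, this.not_gt]

/-- The affine functions of the coordinates, with integer coefficients and constant term in `D`. -/
def affForms (β : Type*) (D : AddSubgroup V) : AddSubgroup ((β → V) → V) :=
  AddSubgroup.closure (range (fun i x => x i) ∪ (fun d _ => d) '' (D : Set V))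

variable {D : AddSubgroup V} {β : Type*}

omit [LinearOrder V] [IsOrderedAddMonoid V] [Nontrivial V] in
theorem proj_mem_affForms (i : β) : (fun x : β → V => x i) ∈ affForms β D :=
  AddSubgroup.subset_closure (Or.inl ⟨i, rfl⟩)

omit [LinearOrder V] [IsOrderedAddMonoid V] [Nontrivial V] in
theorem const_mem_affForms {d : V} (hd : d ∈ D) : (fun _ : β → V => d) ∈ affForms β D :=
  AddSubgroup.subset_closure (Or.inr ⟨d, hd, rfl⟩)

omit [LinearOrder V] [IsOrderedAddMonoid V] [Nontrivial V] in
theorem affForms_split {n : ℕ} {γ : Type*} {f : (γ ⊕ Fin (n + 1) → V) → V}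
    (hf : f ∈ affForms (γ ⊕ Fin (n + 1)) D) :
    ∃ c : ℤ, ∃ g ∈ affForms (γ ⊕ Fin n) D, ∀ v xs y,
      f (Sum.elim v (Fin.snoc xs y)) = g (Sum.elim v xs) + c • y := by
  induction hf using AddSubgroup.closure_induction with
  | mem f hf =>
    rcases hf with ⟨i, rfl⟩ | ⟨d, hd, rfl⟩
    · rcases i with i | i
      · exact ⟨0, _, proj_mem_affForms (Sum.inl i), by simp⟩
      · induction i using Fin.lastCases with
        | last => exact ⟨1, 0, zero_mem _, by simp⟩
        | cast i => exact ⟨0, _, proj_mem_affForms (Sum.inr i), by simp⟩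
    · exact ⟨0, _, const_mem_affForms hd, by simp⟩
  | zero => exact ⟨0, 0, zero_mem _, by simp⟩
  | add f f' _ _ h h' =>
    obtain ⟨c, g, hg, e⟩ := h
    obtain ⟨c', g', hg', e'⟩ := h'
    refine ⟨c + c', g + g', add_mem hg hg', fun v xs y => ?_⟩
    simp only [Pi.add_apply, e, e', add_smul]
    abel
  | neg f _ h =>
    obtain ⟨c, g, hg, e⟩ := h
    refine ⟨-c, -g, neg_mem hg, fun v xs y => ?_⟩
    simp only [Pi.neg_apply, e, neg_smul]
    abel

omit [LinearOrder V] [IsOrderedAddMonoid V] [Nontrivial V] in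
theorem affForms_unit {f : (Unit ⊕ Fin 0 → V) → V} (hf : f ∈ affForms (Unit ⊕ Fin 0) D) :
    ∃ c : ℤ, ∃ d ∈ D, ∀ x, f x = c • x (Sum.inl ()) + d := by
  induction hf using AddSubgroup.closure_induction with
  | mem f hf =>
    rcases hf with ⟨i, rfl⟩ | ⟨d, hd, rfl⟩
    · rcases i with i | i
      · exact ⟨1, 0, zero_mem _, by simp⟩
      · exact i.elim0
    · exact ⟨0, d, hd, by simp⟩
  | zero => exact ⟨0, 0, zero_mem _, by simp⟩
  | add f f' _ _ h h' =>
    obtain ⟨c, g, hg, e⟩ := h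
    obtain ⟨c', g', hg', e'⟩ := h'
    refine ⟨c + c', g + g', add_mem hg hg', fun x => ?_⟩
    simp only [Pi.add_apply, e, e', add_smul]
    abel
  | neg f _ h =>
    obtain ⟨c, g, hg, e⟩ := h
    refine ⟨-c, -g, neg_mem hg, fun x => ?_⟩
    simp only [Pi.neg_apply, e, neg_smul]
    abel

/-- The predicate `P` only depends on the signs of finitely many affine functions. -/
def SignDetermined (D : AddSubgroup V) (P : (β → V) → Prop) : Prop :=
  ∃ F : Set ((β → V) → V), F.Finite ∧ F ⊆ affForms β D ∧ ∀ x x',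
    (∀ f ∈ F, SignType.sign (f x) = SignType.sign (f x')) → (P x ↔ P x')

omit [IsOrderedAddMonoid V] [Nontrivial V] in
theorem signDetermined_sign {f : (β → V) → V} (hf : f ∈ affForms β D) (p : SignType → Prop) :
    SignDetermined D fun x => p (SignType.sign (f x)) :=
  ⟨{f}, finite_singleton f, by simpa using hf, fun x x' h => by simp only [h f rfl]⟩

include hdiv in
-- Fourier–Motzkin elimination of `y`: the new family consists of the parts free of `y` and the
-- pairwise eliminants, exactly the data that `exists_sign_eq` needs to transfer a counterexample.
theorem SignDetermined.all {n : ℕ} {γ : Type*} {P : (γ ⊕ Fin (n + 1) → V) → Prop}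
    (h : SignDetermined D P) :
    SignDetermined D fun x : γ ⊕ Fin n → V =>
      ∀ y, P (Sum.elim (x ∘ Sum.inl) (Fin.snoc (x ∘ Sum.inr) y)) := by
  obtain ⟨F, hF, hFD, hP⟩ := h
  have := hF.to_subtype
  choose c g hg e using fun f : F => affForms_split (hFD f.2)
  refine ⟨range g ∪ range (fun p : F × F => c p.2 • g p.1 - c p.1 • g p.2),
    (finite_range _).union (finite_range _), ?_, ?_⟩
  · rintro f (⟨i, rfl⟩ | ⟨p, rfl⟩)
    · exact hg i
    · exact sub_mem (zsmul_mem (hg _) _) (zsmul_mem (hg _) _)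
  · have key : ∀ x x' : γ ⊕ Fin n → V, (∀ f ∈ range g ∪
        range (fun p : F × F => c p.2 • g p.1 - c p.1 • g p.2),
        SignType.sign (f x) = SignType.sign (f x')) →
        (∀ y, P (Sum.elim (x ∘ Sum.inl) (Fin.snoc (x ∘ Sum.inr) y))) →
        ∀ y, P (Sum.elim (x' ∘ Sum.inl) (Fin.snoc (x' ∘ Sum.inr) y)) := by
      intro x x' h hx y
      obtain ⟨y', hy'⟩ := exists_sign_eq hdiv c (fun i => g i x') (fun i => g i x)
        (fun i => (h _ (Or.inl ⟨i, rfl⟩)).symm) (fun i j => (h _ (Or.inr ⟨(i, j), rfl⟩)).symm) y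
      refine (hP _ _ fun f hf => ?_).2 (hx y')
      have := e ⟨f, hf⟩
      simp only at this
      rw [this, this, Sum.elim_comp_inl_inr, Sum.elim_comp_inl_inr]
      exact hy' ⟨f, hf⟩
    exact fun x x' h => ⟨key x x' h, key x' x fun f hf => (h f hf).symm⟩

/-- The symbols of `L` are interpreted by affine functions and affine inequalities over `D`. -/
structure IsAffineOver (L : FirstOrder.Language.{u, v}) [L.Structure V] (D : AddSubgroup V) :
    Prop where
  funMap : ∀ n (f : L.Functions n), ∃ k : Fin n → ℤ, ∃ d ∈ D, ∀ x : Fin n → V,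
    Structure.funMap f x = ∑ i, k i • x i + d
  relMap : ∀ n (r : L.Relations n), ∃ k : Fin n → ℤ, ∃ d ∈ D, ∀ x : Fin n → V,
    Structure.RelMap r x ↔ 0 < ∑ i, k i • x i + d

variable {L : FirstOrder.Language.{u, v}} [L.Structure V]
  (haff : IsAffineOver L D)

omit [IsOrderedAddMonoid V] [Nontrivial V] in
include haff in
-- Naming constants from `D` only adds affine functions with no linear part. It gets applied twice,
-- to the named values and to the parameters of a type.
theorem IsAffineOver.withConstants {A : Set V} (hA : A ⊆ D) : IsAffineOver (L[[A]]) D where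
  funMap n f := by
    rcases f with f | f
    · obtain ⟨k, d, hd, e⟩ := haff.funMap n f
      exact ⟨k, d, hd, fun x => (withConstants_funMap_sumInl (L := L)).trans (e x)⟩
    · match n, f with
      | 0, c => exact ⟨0, c.1, hA c.2, fun x => by
          have : Structure.funMap (L := L[[A]]) (Sum.inr c : L[[A]].Functions 0) x = Subtype.val (p := (· ∈ A)) c :=
            rfl
          rw [this]
          simp⟩
  relMap n r := by
    rcases r with r | r
    · obtain ⟨k, d, hd, e⟩ := haff.relMap n r
      exact ⟨k, d, hd, fun x => (iff_of_eq (withConstants_relMap_sumInl (L := L))).trans (e x)⟩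
    · exact r.elim

omit [IsOrderedAddMonoid V] [Nontrivial V] in
include haff in
theorem realize_mem_affForms (t : L.Term β) :
    (fun x : β → V => t.realize x) ∈ affForms β D := by
  induction t with
  | var i => exact proj_mem_affForms i
  | func f ts ih =>
    obtain ⟨k, d, hd, e⟩ := haff.funMap _ f
    have : (fun x : β → V => (Term.func f ts).realize x) =
        (∑ i, k i • (fun x : β → V => (ts i).realize x)) + fun _ => d := by
      ext x
      simp [Term.realize_func, e]
    rw [this]
    exact add_mem (sum_mem fun i _ => zsmul_mem (ih i) _) (const_mem_affForms hd)

include hdiv haff in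
/-- Quantifier elimination for divisible ordered abelian groups. -/
theorem signDetermined_realize {γ : Type*} {n : ℕ} (φ : L.BoundedFormula γ n) :
    SignDetermined D fun x : γ ⊕ Fin n → V => φ.Realize (x ∘ Sum.inl) (x ∘ Sum.inr) := by
  induction φ with
  | falsum => exact ⟨∅, finite_empty, empty_subset _, fun _ _ _ => Iff.rfl⟩
  | equal t₁ t₂ =>
    convert signDetermined_sign (sub_mem (realize_mem_affForms haff t₁)
      (realize_mem_affForms haff t₂)) (fun s => s = 0) using 2 with x
    simp [BoundedFormula.Realize, sign_eq_zero_iff, sub_eq_zero, Sum.elim_comp_inl_inr]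
  | @rel n l r ts =>
    obtain ⟨k, d, hd, e⟩ := haff.relMap _ r
    convert signDetermined_sign (add_mem (sum_mem fun i (_ : i ∈ Finset.univ) =>
      zsmul_mem (realize_mem_affForms haff (ts i)) (k i)) (const_mem_affForms hd))
      (fun s => s = 1) using 2 with x
    simp [BoundedFormula.Realize, sign_eq_one_iff, Sum.elim_comp_inl_inr, e]
  | imp φ ψ h₁ h₂ =>
    obtain ⟨F, hF, hFD, hP⟩ := h₁
    obtain ⟨F', hF', hFD', hP'⟩ := h₂
    refine ⟨F ∪ F', hF.union hF', union_subset hFD hFD', fun x x' h => ?_⟩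
    simp only [BoundedFormula.realize_imp]
    exact imp_congr (hP x x' fun f hf => h f (Or.inl hf)) (hP' x x' fun f hf => h f (Or.inr hf))
  | all φ h =>
    convert h.all hdiv using 2 with x
    simp only [BoundedFormula.realize_all, Sum.elim_comp_inl, Sum.elim_comp_inr]

include hdiv haff in
-- The separating points are the zeros of the affine functions c x + d from quantifier elimination;
-- `hD` keeps the quotients -d/c inside `D`.
theorem exists_determinedBy_of_divisible (hD : ∀ n : ℤ, n ≠ 0 → ∀ v : V, n • v ∈ D → v ∈ D)
    (φ : L.Formula Unit) :
    ∃ F : Finset V, (F : Set V) ⊆ D ∧ DeterminedBy F {x | φ.Realize fun _ => x} := by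
  classical
  obtain ⟨F, hF, hFD, hP⟩ := signDetermined_realize hdiv haff φ
  have := hF.to_subtype
  choose c d hd e using fun f : F => affForms_unit (hFD f.2)
  have hz : ∀ i, ∃ t ∈ D, c i ≠ 0 → d i = -(c i • t) := fun i => by
    by_cases hc : c i = 0
    · exact ⟨0, zero_mem D, fun h => absurd hc h⟩
    · obtain ⟨t, ht⟩ := hdiv (c i) hc (-d i)
      exact ⟨t, hD _ hc _ (ht ▸ neg_mem (hd i)), fun _ => by rw [ht, neg_neg]⟩
  choose t htD ht using hz
  refine ⟨(finite_range t).toFinset, ?_, fun a b hab ha => ?_⟩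
  · rintro _ h
    obtain ⟨i, rfl⟩ := (Finite.mem_toFinset _).1 h
    exact htD i
  · simp only [Finite.mem_toFinset, mem_range, forall_exists_index,
      forall_apply_eq_imp_iff] at hab
    have := (hP (Sum.elim (fun _ => a) Fin.elim0) (Sum.elim (fun _ => b) Fin.elim0) ?_).1
    · simpa [Formula.Realize, Subsingleton.elim (default : Fin 0 → V) Fin.elim0] using! this (by
        simpa [Formula.Realize, Subsingleton.elim (default : Fin 0 → V) Fin.elim0] using! ha)
    · intro f hf
      have e := e ⟨f, hf⟩
      simp only at e
      rw [e, e]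
      by_cases hc : c ⟨f, hf⟩ = 0
      · simp [hc]
      · have e' : ∀ s z : V, c ⟨f, hf⟩ • z + -(c ⟨f, hf⟩ • s) = c ⟨f, hf⟩ • (z - s) := by
          intro s z
          rw [smul_sub]; abel
        rw [ht _ hc, e', e', sign_zsmul_eq_mul, sign_zsmul_eq_mul]
        congr 1
        exact sign_sub_eq_iff.2 (hab _)

end DivisibleGroups

/-! ### The natural valuation and the three ways of filling a cut. -/

section Valuation

open Set ArchimedeanClass

theorem exists_cofinal_sequence (Γ : Type w) [LinearOrder Γ] [Nonempty Γ] [NoMaxOrder Γ] :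
    ∃ l : Ordinal.{w}, ω ≤ l ∧ ∃ f : Set.Iio l → Γ, StrictMono f ∧ ∀ γ, ∃ ρ, γ ≤ f ρ := by
  -- `S` consists of the records of a well-ordering: elements larger than everything enumerated
  -- before them. They are cofinal, and on them `<` is well-founded.
  set S : Set Γ := {a | ∀ b, WellOrderingRel b a → b < a} with hS
  have hcof : IsCofinal S := isCofinal_setOfPred_imp_lt WellOrderingRel
  have hsub : ∀ a b : S, a < b → WellOrderingRel a.1 b.1 := by
    intro a b hab
    rcases trichotomous_of WellOrderingRel a.1 b.1 with h | h | h
    · exact h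
    · exact absurd h (Subtype.coe_lt_coe.2 hab).ne
    · exact absurd (a.2 _ h) (Subtype.coe_lt_coe.2 hab).not_gt
  have hwf : WellFoundedLT S :=
    ⟨Subrelation.wf (fun {a b} h => hsub a b h) (InvImage.wf (Subtype.val : S → Γ)
      (IsWellFounded.wf (r := WellOrderingRel)))⟩
  refine ⟨Ordinal.type (fun a b : S => a < b), ?_,
    fun ρ => (Ordinal.enum (fun a b : S => a < b) ρ).1, ?_, ?_⟩
  · by_contra h
    obtain ⟨n, hn⟩ := Ordinal.lt_omega0.1 (not_le.1 h)
    have hfin : S.Finite := by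
      rw [← Cardinal.lt_aleph0_iff_set_finite, ← Ordinal.card_type (fun a b : S => a < b), hn]
      simp
    have : Nonempty Γ := inferInstance
    exact not_bddAbove_iff_isCofinal.2 hcof hfin.bddAbove
  · intro ρ σ h
    exact Ordinal.enum_lt_enum.2 h
  · intro γ
    obtain ⟨s, hs, hγ⟩ := hcof γ
    exact ⟨(Ordinal.enum (fun a b : S => a < b)).symm ⟨s, hs⟩, by simpa using hγ⟩

variable {M N : Type w} [Field M] [LinearOrder M] [IsStrictOrderedRing M]
  [Field N] [LinearOrder N] [IsStrictOrderedRing N]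

/-- Here |x - a| < |a - d|, so moving from `a` to `x` cannot cross `d`. -/
theorem lt_iff_of_mk_lt {x a d : M} (h : ArchimedeanClass.mk (a - d) < ArchimedeanClass.mk (x - a)) :
    (d < x ↔ d < a) ∧ (x < d ↔ a < d) := by
  have := ArchimedeanClass.mk_lt_mk.1 h 1
  rw [one_smul] at this
  grind

theorem mk_map_lt_iff (i : M →+*o N) {a b : M} :
    ArchimedeanClass.mk (i a) < ArchimedeanClass.mk (i b) ↔
      ArchimedeanClass.mk a < ArchimedeanClass.mk b := by
  have hinj : Function.Injective i := RingHom.injective (i : M →+* N)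
  have h : StrictMono (ArchimedeanClass.orderHom (i : M →+o N)) :=
    (ArchimedeanClass.orderHom (i : M →+o N)).monotone.strictMono_of_injective
      (ArchimedeanClass.orderHom_injective hinj)
  exact h.lt_iff_lt (a := ArchimedeanClass.mk a) (b := ArchimedeanClass.mk b)

omit [IsStrictOrderedRing M] [IsStrictOrderedRing N] in
theorem map_lt_iff (i : M →+*o N) {a b : M} : i a < i b ↔ a < b :=
  (i.monotone'.strictMono_of_injective (RingHom.injective (i : M →+* N))).lt_iff_lt

theorem le_stdPart_ratCast {x : M} {q : ℚ} (hx : 0 ≤ ArchimedeanClass.mk x) (h : (q : M) ≤ x) :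
    (q : ℝ) ≤ stdPart x := by
  simpa using stdPart_monotoneOn (mk_ratCast_nonneg q) hx h

theorem stdPart_ratCast_le {x : M} {q : ℚ} (hx : 0 ≤ ArchimedeanClass.mk x) (h : x ≤ (q : M)) :
    stdPart x ≤ q := by
  simpa using stdPart_monotoneOn hx (mk_ratCast_nonneg q) h

theorem mk_map_nonneg (i : M →+*o N) {x : M} (hx : 0 ≤ ArchimedeanClass.mk x) :
    0 ≤ ArchimedeanClass.mk (i x) := by
  by_contra! h
  rw [← ArchimedeanClass.mk_one, ← map_one i, mk_map_lt_iff, ArchimedeanClass.mk_one] at h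
  exact h.not_ge hx

/-- A standard part is determined by comparisons with rationals, which `i` preserves and reflects.
-/
theorem stdPart_map (i : M →+*o N) {x : M} (hx : 0 ≤ ArchimedeanClass.mk x) :
    stdPart (i x) = stdPart x := by
  have hx' := mk_map_nonneg i hx
  rcases lt_trichotomy (stdPart (i x)) (stdPart x) with h | h | h
  · obtain ⟨q, h1, h2⟩ := exists_rat_btwn h
    have h3 : (q : M) < x := by
      by_contra! h'
      exact h2.not_ge (stdPart_ratCast_le hx h')
    rw [← map_lt_iff i, map_ratCast] at h3
    exact absurd (le_stdPart_ratCast hx' h3.le) h1.not_ge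
  · exact h
  · obtain ⟨q, h1, h2⟩ := exists_rat_btwn h
    have h3 : x < (q : M) := by
      by_contra! h'
      exact h1.not_ge (le_stdPart_ratCast hx h')
    rw [← map_lt_iff i, map_ratCast] at h3
    exact absurd (stdPart_ratCast_le hx' h3.le) h2.not_ge

theorem lt_iff_stdPart_lt {x y : M} (hx : 0 ≤ ArchimedeanClass.mk x)
    (hy : 0 ≤ ArchimedeanClass.mk y) (hne : stdPart x ≠ stdPart y) :
    x < y ↔ stdPart x < stdPart y :=
  ⟨fun h => (stdPart_monotoneOn hx hy h.le).lt_of_ne hne,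
    fun h => by
      by_contra! h'
      exact h.not_ge (stdPart_monotoneOn hy hx h')⟩

/-- Every ordered embedding of the residue field into ℝ computes the standard part, so any
isomorphism with ℝ does as well. -/
theorem exists_stdPart_eq (h : Nonempty (FiniteResidueField M ≃+*o ℝ)) (r : ℝ) :
    ∃ y : M, 0 ≤ ArchimedeanClass.mk y ∧ stdPart y = r := by
  obtain ⟨f⟩ := h
  obtain ⟨z, hz⟩ : ∃ z, f z = r := f.surjective r
  induction z with
  | mk y =>
    refine ⟨y.1, y.2, ?_⟩
    rw [stdPart_of_mk_nonneg (f : FiniteResidueField M →+*o ℝ) y.2, ← hz]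
    rfl

theorem nonempty_residueField_iso
    (h : ∀ r : ℝ, ∃ y : M, 0 ≤ ArchimedeanClass.mk y ∧ stdPart y = r) :
    Nonempty (FiniteResidueField M ≃+*o ℝ) := by
  let f : FiniteResidueField M →+*o ℝ := Classical.ofNonempty
  have hinj : Function.Injective f := RingHom.injective (f : FiniteResidueField M →+* ℝ)
  have hsurj : Function.Surjective f := fun r => by
    obtain ⟨y, hy, rfl⟩ := h r
    exact ⟨_, (stdPart_of_mk_nonneg f hy).symm⟩
  exact ⟨{ RingEquiv.ofBijective (f : FiniteResidueField M →+* ℝ) ⟨hinj, hsurj⟩ with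
    map_le_map_iff' := (f.monotone'.strictMono_of_injective hinj).le_iff_le }⟩

section Cut

variable (i : M →+*o N) (D : Subfield M) (x : N)

/-- `y` realizes the same cut over `D` as `x`. -/
def SameCut (y : M) : Prop := ∀ d ∈ D, (i d < x ↔ d < y) ∧ (x < i d ↔ y < d)

variable {i D x}

/-- For each d in D some term a_ρ is closer to x than d is. Since y approximates a_ρ with the same
value as x does, both lie on the side of d where a_ρ lies. -/
theorem exists_sameCut_of_immediate
    (hpc : ∀ (l : Ordinal.{w}), ω ≤ l → ∀ a : Set.Iio l → M, (∀ ρ, a ρ ∈ D) →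
      IsPseudoCauchy a → ∃ y : M, IsPseudoLimit a y)
    (h : ∀ d ∈ D, ∃ d' ∈ D, ArchimedeanClass.mk (x - i d) < ArchimedeanClass.mk (x - i d')) :
    ∃ y, SameCut i D x y := by
  let Γ : Set (ArchimedeanClass N) := range fun d : D => ArchimedeanClass.mk (x - i d)
  have : Nonempty Γ := ⟨⟨_, ⟨0, rfl⟩⟩⟩
  have : NoMaxOrder Γ := ⟨by
    rintro ⟨_, ⟨d, rfl⟩⟩
    obtain ⟨d', hd', hlt⟩ := h d d.2
    exact ⟨⟨_, ⟨⟨d', hd'⟩, rfl⟩⟩, hlt⟩⟩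
  obtain ⟨l, hl, f, hf, hcof⟩ := exists_cofinal_sequence Γ
  choose a ha using fun ρ => (f ρ).2
  have hmono : ∀ ρ σ, ρ < σ →
      ArchimedeanClass.mk (x - i (a ρ)) < ArchimedeanClass.mk (x - i (a σ)) := by
    intro ρ σ h
    have := hf h
    rw [← Subtype.coe_lt_coe, ← ha, ← ha] at this
    exact this
  have hval : ∀ ρ σ, ρ < σ →
      ArchimedeanClass.mk (i (a σ - a ρ)) = ArchimedeanClass.mk (x - i (a ρ)) := by
    intro ρ σ h
    have := ArchimedeanClass.mk_sub_eq_mk_left (hmono ρ σ h)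
    rwa [sub_sub_sub_cancel_left, ← map_sub] at this
  obtain ⟨y, hy⟩ := hpc l hl (fun ρ => a ρ) (fun ρ => (a ρ).2) fun ρ σ τ h1 h2 => by
    rw [← mk_map_lt_iff i, hval ρ σ h1, hval σ τ h2]
    exact hmono ρ σ h1
  refine ⟨y, fun d hd => ?_⟩
  obtain ⟨d', hd', hlt⟩ := h d hd
  obtain ⟨ρ, hρ⟩ := hcof ⟨_, ⟨⟨d', hd'⟩, rfl⟩⟩
  -- An index beyond ρ is needed, because the pseudo-limit condition expresses v(y - a_ρ) through a
  -- later term.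
  obtain ⟨γ, hγ⟩ := exists_gt (f ρ)
  obtain ⟨σ, hσ⟩ := hcof γ
  have hρσ : ρ < σ := hf.lt_iff_lt.1 (hγ.trans_le hσ)
  rw [← Subtype.coe_le_coe, ← ha ρ] at hρ
  have h1 : ArchimedeanClass.mk (x - i d) < ArchimedeanClass.mk (x - i (a ρ)) := hlt.trans_le hρ
  have h2 : ArchimedeanClass.mk (i (a ρ) - i d) < ArchimedeanClass.mk (x - i (a ρ)) := by
    have := ArchimedeanClass.mk_sub_eq_mk_left h1
    rw [sub_sub_sub_cancel_left] at this
    rwa [this]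
  have h3 : ArchimedeanClass.mk ((a ρ : M) - d) < ArchimedeanClass.mk (y - a ρ) := by
    rw [hy ρ σ hρσ, ← mk_map_lt_iff i, hval ρ σ hρσ, map_sub]
    exact h2
  obtain ⟨e1, e2⟩ := lt_iff_of_mk_lt h2
  obtain ⟨e3, e4⟩ := lt_iff_of_mk_lt h3
  rw [e1, e2, e3, e4, map_lt_iff, map_lt_iff]
  exact ⟨Iff.rfl, Iff.rfl⟩

/-- No d - a has the value of x - a. If v(d - a) is smaller, `a` decides on which side of d both
points lie; if it is larger, the sign of x - a decides. -/
theorem exists_sameCut_of_value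
    (hval : ∀ S T : Set (ValueGroup M), S ⊆ valueSet (D : Set M) → T ⊆ valueSet (D : Set M) →
      (∀ s ∈ S, ∀ t ∈ T, s < t) → ∃ g, (∀ s ∈ S, s < g) ∧ ∀ t ∈ T, g < t)
    {a : M} (ha : a ∈ D) (hx : x ≠ i a)
    (h : ∀ b ∈ D, ArchimedeanClass.mk (i b) ≠ ArchimedeanClass.mk (x - i a)) :
    ∃ y, SameCut i D x y := by
  obtain ⟨g, hS, hT⟩ := hval
    {γ | ∃ b ∈ D, b ≠ 0 ∧ ArchimedeanClass.mk b = γ.1 ∧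
      ArchimedeanClass.mk (i b) < ArchimedeanClass.mk (x - i a)}
    {γ | ∃ b ∈ D, b ≠ 0 ∧ ArchimedeanClass.mk b = γ.1 ∧
      ArchimedeanClass.mk (x - i a) < ArchimedeanClass.mk (i b)}
    (fun γ ⟨b, h1, h2, h3, _⟩ => ⟨b, h1, h2, h3⟩) (fun γ ⟨b, h1, h2, h3, _⟩ => ⟨b, h1, h2, h3⟩)
    (by
      rintro ⟨s, hs0⟩ ⟨b, -, -, hb, hbx⟩ ⟨t, ht0⟩ ⟨c, -, -, hc, hcx⟩
      rw [Subtype.mk_lt_mk]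
      have := (mk_map_lt_iff i).1 (hbx.trans hcx)
      rwa [hb, hc] at this)
  -- The value `g` fixes `c` only up to sign; the sign is chosen to be that of x - a.
  obtain ⟨c, hc, hcs⟩ : ∃ c, ArchimedeanClass.mk c = g.1 ∧ (i a < x ↔ 0 < c) ∧ (x < i a ↔ c < 0) := by
    obtain ⟨c, hc⟩ := ArchimedeanClass.mk_surjective M g.1
    have hc0 : 0 < |c| := abs_pos.2 fun h0 => g.2 (by rw [← hc, h0, ArchimedeanClass.mk_zero])
    rcases hx.lt_or_gt with h | h
    · exact ⟨-|c|, by rw [ArchimedeanClass.mk_neg, ArchimedeanClass.mk_abs, hc], by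
        simp [h.not_gt, hc0.le], by simpa [h] using hc0⟩
    · exact ⟨|c|, by rw [ArchimedeanClass.mk_abs, hc], by simpa [h] using hc0, by
        simp [h.not_gt, hc0.le]⟩
  refine ⟨a + c, fun d hd => ?_⟩
  rcases (h (d - a) (sub_mem hd ha)).lt_or_gt with hlt | hlt
  · have hne : d - a ≠ 0 := fun h0 => by simp [h0] at hlt
    have h1 := hS ⟨ArchimedeanClass.mk (d - a), by simpa using hne⟩
      ⟨d - a, sub_mem hd ha, hne, rfl, hlt⟩
    rw [← Subtype.coe_lt_coe, ← hc] at h1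
    have h2 : ArchimedeanClass.mk (a - d) < ArchimedeanClass.mk (a + c - a) := by
      rwa [ArchimedeanClass.mk_sub_comm, add_sub_cancel_left]
    have h3 : ArchimedeanClass.mk (i a - i d) < ArchimedeanClass.mk (x - i a) := by
      rwa [ArchimedeanClass.mk_sub_comm, ← map_sub]
    obtain ⟨e1, e2⟩ := lt_iff_of_mk_lt h3
    obtain ⟨e3, e4⟩ := lt_iff_of_mk_lt h2
    rw [e1, e2, e3, e4, map_lt_iff, map_lt_iff]
    exact ⟨Iff.rfl, Iff.rfl⟩
  · have h2 : ArchimedeanClass.mk (a - (a + c)) < ArchimedeanClass.mk (d - a) := by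
      rw [ArchimedeanClass.mk_sub_comm, add_sub_cancel_left, hc]
      by_cases h0 : d - a = 0
      · rw [h0, ArchimedeanClass.mk_zero]
        exact lt_top_iff_ne_top.2 g.2
      · exact Subtype.coe_lt_coe.2 (hT ⟨ArchimedeanClass.mk (d - a), by simpa using h0⟩
          ⟨d - a, sub_mem hd ha, h0, rfl, hlt⟩)
    have h3 : ArchimedeanClass.mk (i a - x) < ArchimedeanClass.mk (i d - i a) := by
      rwa [ArchimedeanClass.mk_sub_comm, ← map_sub]
    obtain ⟨e1, e2⟩ := lt_iff_of_mk_lt h3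
    obtain ⟨e3, e4⟩ := lt_iff_of_mk_lt h2
    rw [e1, e2, e3, e4, hcs.1, hcs.2]
    simp

theorem mk_lt_mk_mul {b z : M} (hb : b ≠ 0) (hz : 0 < ArchimedeanClass.mk z) :
    ArchimedeanClass.mk b < ArchimedeanClass.mk (b * z) := by
  rw [← ArchimedeanClass.mk_one, ArchimedeanClass.mk_lt_mk] at hz
  rw [ArchimedeanClass.mk_lt_mk]
  intro n
  have := hz n
  rw [abs_one] at this
  calc n • |b * z| = |b| * (n • |z|) := by rw [abs_mul, mul_smul_comm]
    _ < |b| * 1 := mul_lt_mul_of_pos_left this (abs_pos.2 hb)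
    _ = |b| := mul_one _

theorem exists_sameCut_of_residue (hres : Nonempty (FiniteResidueField M ≃+*o ℝ))
    {a b : M} (ha : a ∈ D) (hb : b ∈ D) (hx : x ≠ i a)
    (hbx : ArchimedeanClass.mk (i b) = ArchimedeanClass.mk (x - i a))
    (hmax : ∀ d ∈ D, ArchimedeanClass.mk (x - i d) ≤ ArchimedeanClass.mk (x - i a)) :
    ∃ y, SameCut i D x y := by
  wlog hb0 : 0 < b generalizing b
  · have hb1 : b ≠ 0 := by
      rintro rfl
      rw [map_zero, ArchimedeanClass.mk_zero, eq_comm, ArchimedeanClass.mk_eq_top_iff,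
        sub_eq_zero] at hbx
      exact hx hbx
    exact this (neg_mem hb) (by rwa [map_neg, ArchimedeanClass.mk_neg])
      (neg_pos.2 (lt_of_le_of_ne (not_lt.1 hb0) hb1))
  have hib : 0 < i b := by rwa [← map_zero i, map_lt_iff]
  -- Rescaling by `a` and `b` reduces the claim to the cut of a unit `t`.
  obtain ⟨t, ht⟩ : ∃ t, x = i a + i b * t := ⟨(x - i a) / i b, by field_simp; ring⟩
  have hmt : ArchimedeanClass.mk t = 0 := by
    have : t = (x - i a) / i b := by rw [ht]; field_simp; ring
    rw [this, ArchimedeanClass.mk_div, hbx]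
    refine LinearOrderedAddCommGroupWithTop.sub_self_eq_zero_of_ne_top ?_
    rw [ne_eq, ArchimedeanClass.mk_eq_top_iff, sub_eq_zero]
    exact hx
  obtain ⟨y, hy, hyr⟩ := exists_stdPart_eq hres (stdPart t)
  refine ⟨a + b * y, fun d hd => ?_⟩
  obtain ⟨e, he, hde⟩ : ∃ e ∈ D, d = a + b * e :=
    ⟨(d - a) / b, div_mem (sub_mem hd ha) hb, by field_simp; ring⟩
  suffices (i e < t ↔ e < y) ∧ (t < i e ↔ y < e) by
    rw [hde, ht, map_add, map_mul]
    simpa [hib, hb0] using this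
  -- Maximality of v(x - a) means that no element of D shares the residue of `t`, so standard parts
  -- alone decide every comparison with finite elements of D.
  have hte : ArchimedeanClass.mk (t - i e) ≤ 0 := by
    by_contra! hlt
    have h1 := mk_lt_mk_mul hib.ne' hlt
    have h2 := hmax d hd
    rw [← hbx, ht, hde, map_add, map_mul, add_sub_add_left_eq_sub, ← _root_.mul_sub] at h2
    exact h1.not_ge h2
  rcases lt_or_ge (ArchimedeanClass.mk e) 0 with h | h
  · have h1 : ArchimedeanClass.mk (0 - e) < ArchimedeanClass.mk (y - 0) := by
      rw [_root_.zero_sub, ArchimedeanClass.mk_neg, _root_.sub_zero]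
      exact h.trans_le hy
    have h2 : ArchimedeanClass.mk (0 - i e) < ArchimedeanClass.mk (t - 0) := by
      rwa [_root_.zero_sub, ArchimedeanClass.mk_neg, _root_.sub_zero, hmt, ← ArchimedeanClass.mk_one,
        ← map_one i, mk_map_lt_iff, ArchimedeanClass.mk_one]
    obtain ⟨e1, e2⟩ := lt_iff_of_mk_lt h2
    obtain ⟨e3, e4⟩ := lt_iff_of_mk_lt h1
    rw [e1, e2, e3, e4, ← map_zero i, map_lt_iff, map_lt_iff]
    exact ⟨Iff.rfl, Iff.rfl⟩
  · have hie := mk_map_nonneg i h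
    have hne : stdPart t ≠ stdPart (i e) := by
      have h0 : ArchimedeanClass.mk (t - i e) = 0 := le_antisymm hte
        ((le_min hmt.ge hie).trans (ArchimedeanClass.min_le_mk_sub _ _))
      have := mt stdPart_eq_zero.1 (not_not.2 h0)
      rwa [stdPart_sub hmt.ge hie, sub_eq_zero] at this
    have hne' : stdPart y ≠ stdPart e := by rwa [hyr, ← stdPart_map i h]
    rw [lt_iff_stdPart_lt hie hmt.ge hne.symm, lt_iff_stdPart_lt h hy hne'.symm,
      lt_iff_stdPart_lt hmt.ge hie hne, lt_iff_stdPart_lt hy h hne', stdPart_map i h, hyr]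
    exact ⟨Iff.rfl, Iff.rfl⟩

/-- If all value cuts, residues and pseudo-limits over `D` are realized in `M`, then `M` realizes
every cut over `D` that is realized in an ordered field extension of `M`. -/
theorem exists_sameCut (i : M →+*o N) (D : Subfield M) (x : N)
    (hval : ∀ S T : Set (ValueGroup M), S ⊆ valueSet (D : Set M) → T ⊆ valueSet (D : Set M) →
      (∀ s ∈ S, ∀ t ∈ T, s < t) → ∃ g, (∀ s ∈ S, s < g) ∧ ∀ t ∈ T, g < t)
    (hres : Nonempty (FiniteResidueField M ≃+*o ℝ))
    (hpc : ∀ (l : Ordinal.{w}), ω ≤ l → ∀ a : Set.Iio l → M, (∀ ρ, a ρ ∈ D) →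
      IsPseudoCauchy a → ∃ y : M, IsPseudoLimit a y) :
    ∃ y, SameCut i D x y := by
  by_cases h : ∀ d ∈ D, ∃ d' ∈ D, ArchimedeanClass.mk (x - i d) < ArchimedeanClass.mk (x - i d')
  · exact exists_sameCut_of_immediate hpc h
  push Not at h
  obtain ⟨a, ha, hmax⟩ := h
  by_cases hx : x = i a
  · exact ⟨a, fun d _ => by rw [hx, map_lt_iff, map_lt_iff]; exact ⟨Iff.rfl, Iff.rfl⟩⟩
  by_cases hb : ∃ b ∈ D, ArchimedeanClass.mk (i b) = ArchimedeanClass.mk (x - i a)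
  · obtain ⟨b, hb, hbx⟩ := hb
    exact exists_sameCut_of_residue hres ha hb hx hbx hmax
  · push Not at hb
    exact exists_sameCut_of_value hval ha hx hb

end Cut

end Valuation

/-! ### Saturation in terms of definable families and cuts. -/

section Saturation

open FirstOrder.Language Set

variable {L : FirstOrder.Language.{u, v}} {X : Type w} [L.Structure X] {κ : Cardinal.{w}}

theorem definable₁_realize {A : Set X} (φ : L[[A]].Formula Unit) :
    A.Definable₁ L {x | φ.Realize fun _ => x} := by
  refine ⟨φ.relabel fun _ => 0, ?_⟩
  ext v
  simp only [mem_ofPred_eq, Formula.realize_relabel]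
  rfl

theorem exists_formula_of_definable₁ {A S : Set X} (h : A.Definable₁ L S) :
    ∃ φ : L[[A]].Formula Unit, ∀ x, (φ.Realize fun _ => x) ↔ x ∈ S := by
  obtain ⟨φ, hφ⟩ := h
  refine ⟨φ.relabel fun _ => (), fun x => ?_⟩
  have := Set.ext_iff.1 hφ fun _ => x
  simp only [mem_ofPred_eq] at this
  rw [this, Formula.realize_relabel]
  rfl

/-- In a saturated structure, small families of definable sets with the finite intersection
property have a common point. -/
theorem IsSaturated.exists_forall_mem (h : IsSaturated L X κ) {A : Set X} (hA : #A < κ)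
    {ι : Type*} (S : ι → Set X) (hS : ∀ i, A.Definable₁ L (S i))
    (hfip : ∀ t : Finset ι, ∃ x, ∀ i ∈ t, x ∈ S i) : ∃ x, ∀ i, x ∈ S i := by
  classical
  choose φ hφ using fun i => exists_formula_of_definable₁ (hS i)
  obtain ⟨x, hx⟩ := h A hA (range φ) (fun q hq => by
    obtain ⟨t, -, rfl⟩ := Finset.subset_set_image_iff.1 (image_univ ▸ hq)
    obtain ⟨x, hx⟩ := hfip t
    refine ⟨x, fun ψ hψ => ?_⟩
    obtain ⟨i, hi, rfl⟩ := Finset.mem_image.1 hψ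
    exact (hφ i x).2 (hx i hi))
  exact ⟨x, fun i => (hφ i x).1 (hx _ ⟨i, rfl⟩)⟩

/-- If the definable sets are cut out by points of sets `D` all of whose cuts are realized, then
the structure is saturated. -/
theorem IsSaturated.of_determinedBy [LinearOrder X]
    (h : ∀ A : Set X, #A < κ → ∃ D : Set X,
      (∀ φ : L[[A]].Formula Unit, ∃ F : Finset X, (F : Set X) ⊆ D ∧
        DeterminedBy F {x | φ.Realize fun _ => x}) ∧
      ∀ U : Ultrafilter X, ∃ y, ∀ d ∈ D, (d < y ↔ Ioi d ∈ U) ∧ (y < d ↔ Iio d ∈ U)) :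
    IsSaturated L X κ := by
  classical
  intro A hA p hp
  obtain ⟨D, hD, hU⟩ := h A hA
  let f : L[[A]].Formula Unit → Set X := fun φ => {x | φ.Realize fun _ => x}
  have hne : (Filter.generate (f '' p)).NeBot := by
    rw [Filter.generate_neBot_iff]
    intro t ht htfin
    lift t to Finset (Set X) using htfin
    obtain ⟨q, hq, rfl⟩ := Finset.subset_set_image_iff.1 ht
    obtain ⟨x, hx⟩ := hp q hq
    refine ⟨x, ?_⟩
    rintro S hS
    obtain ⟨φ, hφ, rfl⟩ := Finset.mem_image.1 (Finset.mem_coe.1 hS)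
    exact hx φ hφ
  -- Finite satisfiability makes the generated filter proper; an ultrafilter above it also decides a
  -- cut over `D`.
  let U : Ultrafilter X := Ultrafilter.of (Filter.generate (f '' p))
  obtain ⟨y, hy⟩ := hU U
  refine ⟨y, fun φ hφ => ?_⟩
  have hφU : f φ ∈ U := Ultrafilter.of_le _ (Filter.mem_generate_of_mem ⟨φ, hφ, rfl⟩)
  obtain ⟨F, hF, hdet⟩ := hD φ
  -- As `F` is finite, `U`-almost every point has the same position as `y` relative to `F`, and one
  -- of these satisfies `φ`.
  have hev : ∀ d ∈ F, ∀ᶠ x in (U : Filter X), (d < x ↔ d < y) ∧ (x < d ↔ y < d) := by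
    intro d hd
    have key : ∀ {q : Prop} {S : Set X}, (q ↔ S ∈ U) → ∀ᶠ x in (U : Filter X), x ∈ S ↔ q := by
      intro q S hq
      by_cases hS : S ∈ U
      · filter_upwards [hS] with x hx
        simp [hx, hq, hS]
      · filter_upwards [Ultrafilter.compl_mem_iff_notMem.2 hS] with x hx
        simp [hq, hS, show x ∉ S from hx]
    exact (key (hy d (hF hd)).1).and (key (hy d (hF hd)).2)
  obtain ⟨x, hx, hxF⟩ := U.nonempty_of_mem
    (Filter.inter_mem hφU ((Filter.eventually_all_finset F).2 hev))
  exact hdet x y hxF hx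

end Saturation

/-! ### The definable closure as a subfield; definability of valuation inequalities. -/

section DefinableClosure

open FirstOrder.Language Set

variable {L : FirstOrder.Language.{u, v}} {M : Type w} [Field M] [LinearOrder M]
  [L.Structure M] (hexp : ExpandsOrderedField L M) {A : Set M}

include hexp

theorem definableFun_add {α : Type*} {f g : (α → M) → M} (hf : A.DefinableFun L f)
    (hg : A.DefinableFun L g) : A.DefinableFun L fun v => f v + g v := by
  obtain ⟨r, hr⟩ := hexp.add_symbol
  convert definableFun_funMap r hf hg using 2 with v
  simp [hr]

theorem definableFun_mul {α : Type*} {f g : (α → M) → M} (hf : A.DefinableFun L f)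
    (hg : A.DefinableFun L g) : A.DefinableFun L fun v => f v * g v := by
  obtain ⟨r, hr⟩ := hexp.mul_symbol
  convert definableFun_funMap r hf hg using 2 with v
  simp [hr]

omit hexp [Field M] [LinearOrder M] in
theorem mem_dcl_of_forall_iff {p : M → Prop} {a : M} (ha : ∀ x, x = a ↔ p x)
    (h : (dcl L A).Definable L {v : Fin 1 → M | p (v 0)}) : a ∈ dcl L A := by
  apply mem_dcl_of_definable
  simpa [Set.Definable₁, ha] using h

theorem zero_mem_dcl : (0 : M) ∈ dcl L A :=
  mem_dcl_of_forall_iff (p := fun x => x + x = x) (fun x => by simp)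
    ((definableFun_add hexp (DefinableFun.proj L) (DefinableFun.proj L)).ofPred_eq
      (DefinableFun.proj L))

theorem one_mem_dcl : (1 : M) ∈ dcl L A :=
  mem_dcl_of_forall_iff (p := fun x => x * x = x ∧ ¬ x = 0)
    (fun x => ⟨by rintro rfl; simp, fun h => mul_left_cancel₀ h.2 (by rw [h.1, mul_one])⟩)
    (definable_and ((definableFun_mul hexp (DefinableFun.proj L) (DefinableFun.proj L)).ofPred_eq
      (DefinableFun.proj L)) (definable_not ((DefinableFun.proj L).ofPred_eq
      (L.definableFun_const _ (zero_mem_dcl hexp)))))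

/-- The definable closure as a subfield. -/
def dclSubfield (A : Set M) : Subfield M where
  carrier := dcl L A
  zero_mem' := zero_mem_dcl hexp
  one_mem' := one_mem_dcl hexp
  add_mem' {a b} ha hb := mem_dcl_of_forall_iff (p := fun x => x = a + b) (fun _ => Iff.rfl)
    ((DefinableFun.proj L).ofPred_eq (definableFun_add hexp (L.definableFun_const _ ha)
      (L.definableFun_const _ hb)))
  mul_mem' {a b} ha hb := mem_dcl_of_forall_iff (p := fun x => x = a * b) (fun _ => Iff.rfl)
    ((DefinableFun.proj L).ofPred_eq (definableFun_mul hexp (L.definableFun_const _ ha)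
      (L.definableFun_const _ hb)))
  neg_mem' {a} ha := mem_dcl_of_forall_iff (p := fun x => x + a = 0)
    (fun x => eq_neg_iff_add_eq_zero)
    ((definableFun_add hexp (DefinableFun.proj L) (L.definableFun_const _ ha)).ofPred_eq
      (L.definableFun_const _ (zero_mem_dcl hexp)))
  inv_mem' a ha := by
    by_cases h0 : a = 0
    · rw [h0, inv_zero]
      exact zero_mem_dcl hexp
    · exact mem_dcl_of_forall_iff (p := fun x => x * a = 1)
        (fun x => (mul_eq_one_iff_eq_inv₀ h0).symm)
        ((definableFun_mul hexp (DefinableFun.proj L) (L.definableFun_const _ ha)).ofPred_eq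
          (L.definableFun_const _ (one_mem_dcl hexp)))

theorem definableFun_pow {α : Type*} {f : (α → M) → M} (hf : (dcl L A).DefinableFun L f) (n : ℕ) :
    (dcl L A).DefinableFun L fun v => f v ^ n := by
  induction n with
  | zero => simpa using L.definableFun_const _ (one_mem_dcl hexp)
  | succ n ih => simpa [pow_succ] using definableFun_mul hexp ih hf

theorem definable_lt_field {α : Type*} {f g : (α → M) → M} (hf : (dcl L A).DefinableFun L f)
    (hg : (dcl L A).DefinableFun L g) : A.Definable L {v | f v < g v} :=
  definable_of_dcl (definable_lt hexp.lt_symbol hf hg)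

/-- The positive root is unique, hence definable. This makes the value group of a definable closure
divisible. -/
theorem exists_root_mem_dcl [IsStrictOrderedRing M] [IsRealClosed M] {a : M} (ha : a ∈ dcl L A)
    (h0 : 0 < a) {n : ℕ} (hn : n ≠ 0) : ∃ r ∈ dcl L A, 0 < r ∧ r ^ n = a := by
  obtain ⟨s, hs⟩ := IsRealClosed.exists_eq_pow_of_nonneg h0.le hn
  have hr : |s| ^ n = a := by rw [← abs_pow, ← hs, abs_of_pos h0]
  have hr0 : 0 < |s| := by
    rw [abs_pos]
    rintro rfl
    rw [zero_pow hn] at hs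
    exact h0.ne' hs
  refine ⟨|s|, ?_, hr0, hr⟩
  refine mem_dcl_of_forall_iff (p := fun x => 0 < x ∧ x ^ n = a) (fun x => ?_)
    (definable_and (definable_lt hexp.lt_symbol (L.definableFun_const _ (zero_mem_dcl hexp))
      (DefinableFun.proj L)) ((definableFun_pow hexp (DefinableFun.proj L) n).ofPred_eq
      (L.definableFun_const _ ha)))
  constructor
  · rintro rfl
    exact ⟨hr0, hr⟩
  · rintro ⟨h1, h2⟩
    exact (pow_left_inj₀ h1.le hr0.le hn).1 (h2.trans hr.symm)

theorem definable₁_nsmul_abs_sub_lt [IsStrictOrderedRing M] {a c : M} (ha : a ∈ dcl L A)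
    (hc : c ∈ dcl L A) (n : ℕ) : A.Definable₁ L {x | n • |x - a| < c} := by
  have hn : (n : M) ∈ dcl L A := natCast_mem (dclSubfield hexp A) n
  have hna : (n : M) * a ∈ dcl L A := (dclSubfield hexp A).mul_mem hn ha
  have h1 : (n : M) * a + c ∈ dcl L A :=
    (dclSubfield hexp A).add_mem hna hc
  have h2 : (n : M) * a - c ∈ dcl L A :=
    (dclSubfield hexp A).sub_mem hna hc
  have hnx : (dcl L A).DefinableFun L fun v : Fin 1 → M => (n : M) * v 0 :=
    definableFun_mul hexp (L.definableFun_const _ hn) (DefinableFun.proj L)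
  have := definable_and (definable_lt_field hexp (L.definableFun_const _ h2) hnx)
    (definable_lt_field hexp hnx (L.definableFun_const _ h1))
  refine (congrArg (A.Definable L) (Set.ext fun v => ?_)).mp this
  simp only [mem_ofPred_eq, _root_.nsmul_eq_mul]
  have e : (n : M) * |v 0 - a| = |n * (v 0 - a)| := by
    rw [abs_mul, abs_of_nonneg (Nat.cast_nonneg (α := M) n)]
  rw [e, abs_lt, _root_.mul_sub]
  constructor <;> rintro ⟨h3, h4⟩ <;> constructor <;> linarith

theorem definable₁_nsmul_lt_abs [IsStrictOrderedRing M] {c : M}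
    (hc : c ∈ dcl L A) (n : ℕ) : A.Definable₁ L {x | n • |c| < |x|} := by
  have hn : (n : M) ∈ dcl L A := natCast_mem (dclSubfield hexp A) n
  have h1 : (n : M) * |c| ∈ dcl L A := by
    refine (dclSubfield hexp A).mul_mem hn ?_
    rcases abs_choice c with h | h <;> rw [h]
    · exact hc
    · exact (dclSubfield hexp A).neg_mem hc
  have h2 : -((n : M) * |c|) ∈ dcl L A := (dclSubfield hexp A).neg_mem h1
  have := (definable_lt_field hexp (L.definableFun_const _ h1)
    (DefinableFun.proj L (i := (0 : Fin 1)))).union (definable_lt_field hexp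
    (DefinableFun.proj L (i := (0 : Fin 1))) (L.definableFun_const _ h2))
  refine (congrArg (A.Definable L) (Set.ext fun v => ?_)).mp this
  simp only [mem_ofPred_eq, _root_.nsmul_eq_mul, mem_union, lt_abs]
  exact or_congr Iff.rfl ⟨fun h => by linarith, fun h => by linarith⟩

end DefinableClosure

/-! ### The value group as a divisible ordered abelian group. -/

section ValueGroupStructure

open FirstOrder.Language Set

variable {M : Type w} [Field M] [LinearOrder M] [IsStrictOrderedRing M]

instance : Zero (ValueGroup M) := ⟨⟨0, ArchimedeanClass.zero_ne_top⟩⟩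

instance : Neg (ValueGroup M) := ⟨fun γ => ⟨-γ.1, by simpa using γ.2⟩⟩

instance : AddCommGroup (ValueGroup M) where
  add_assoc a b c := Subtype.ext (_root_.add_assoc a.1 b.1 c.1)
  zero_add a := Subtype.ext (_root_.zero_add a.1)
  add_zero a := Subtype.ext (_root_.add_zero a.1)
  add_comm a b := Subtype.ext (_root_.add_comm a.1 b.1)
  neg_add_cancel a := Subtype.ext ((_root_.add_comm (-a.1) a.1).trans
    (LinearOrderedAddCommGroupWithTop.add_neg_cancel_of_ne_top a.2))
  nsmul := nsmulRec
  zsmul := zsmulRec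

instance : IsOrderedAddMonoid (ValueGroup M) where
  add_le_add_left a b h c := by
    have h' : a.1 ≤ b.1 := h
    have : a.1 + c.1 ≤ b.1 + c.1 := add_le_add_left h' c.1
    exact this

theorem ValueGroup.coe_add (γ δ : ValueGroup M) : (γ + δ).1 = γ.1 + δ.1 := rfl

theorem ValueGroup.coe_nsmul (n : ℕ) (γ : ValueGroup M) : (n • γ).1 = n • γ.1 := by
  induction n with
  | zero => simp only [zero_smul]; rfl
  | succ n ih => rw [succ_nsmul, succ_nsmul, ValueGroup.coe_add, ih]

/-- The value of a nonzero element. -/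
def valueOf (a : M) (ha : a ≠ 0) : ValueGroup M :=
  ⟨ArchimedeanClass.mk a, by simpa using ha⟩

theorem exists_valueOf_eq (γ : ValueGroup M) : ∃ a, ∃ ha : a ≠ 0, valueOf a ha = γ := by
  obtain ⟨a, ha⟩ := ArchimedeanClass.mk_surjective M γ.1
  exact ⟨a, fun h => γ.2 (by rw [← ha, h, ArchimedeanClass.mk_zero]), Subtype.ext ha⟩

theorem mem_valueSet_iff {S : Set M} {γ : ValueGroup M} :
    γ ∈ valueSet S ↔ ∃ a ∈ S, ∃ ha : a ≠ 0, valueOf a ha = γ :=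
  ⟨fun ⟨a, h1, h2, h3⟩ => ⟨a, h1, h2, Subtype.ext h3⟩, fun ⟨a, h1, h2, h3⟩ =>
    ⟨a, h1, h2, congrArg Subtype.val h3⟩⟩

theorem valueOf_lt_iff {a b : M} {ha : a ≠ 0} {hb : b ≠ 0} :
    valueOf a ha < valueOf b hb ↔ ∀ n : ℕ, n • |b| < |a| :=
  ArchimedeanClass.mk_lt_mk

/-- The values of a subfield form a subgroup of the value group. -/
def valueSubgroup (D : Subfield M) : AddSubgroup (ValueGroup M) where
  carrier := valueSet (D : Set M)
  add_mem' := by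
    rintro γ δ ⟨a, ha, ha0, hγ⟩ ⟨b, hb, hb0, hδ⟩
    exact ⟨a * b, D.mul_mem ha hb, mul_ne_zero ha0 hb0, by
      rw [ArchimedeanClass.mk_mul, hγ, hδ]; rfl⟩
  zero_mem' := ⟨1, D.one_mem, one_ne_zero, rfl⟩
  neg_mem' := by
    rintro γ ⟨a, ha, ha0, hγ⟩
    exact ⟨a⁻¹, D.inv_mem ha, inv_ne_zero ha0, by rw [ArchimedeanClass.mk_inv, hγ]; rfl⟩

theorem exists_zsmul_eq_of_roots {D : AddSubgroup (ValueGroup M)}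
    (h : ∀ n : ℕ, n ≠ 0 → ∀ γ ∈ D, ∃ δ ∈ D, n • δ = γ) {n : ℤ} (hn : n ≠ 0) {γ : ValueGroup M}
    (hγ : γ ∈ D) : ∃ δ ∈ D, n • δ = γ := by
  obtain ⟨δ, hδ, e⟩ := h n.natAbs (by simpa using hn) γ hγ
  rcases n.natAbs_eq with h' | h'
  · exact ⟨δ, hδ, by rw [h', natCast_zsmul, e]⟩
  · exact ⟨-δ, neg_mem hδ, by rw [h', neg_smul, smul_neg, neg_neg, natCast_zsmul, e]⟩

theorem exists_zsmul_mem_valueSubgroup {D : Subfield M}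
    (hD : ∀ a ∈ D, 0 < a → ∀ n : ℕ, n ≠ 0 → ∃ r ∈ D, 0 < r ∧ r ^ n = a) {n : ℤ} (hn : n ≠ 0)
    {γ : ValueGroup M} (hγ : γ ∈ valueSubgroup D) : ∃ δ ∈ valueSubgroup D, n • δ = γ := by
  refine exists_zsmul_eq_of_roots (fun n hn γ hγ => ?_) hn hγ
  obtain ⟨a, ha, ha0, hγ⟩ := hγ
  have haD : |a| ∈ D := by
    rcases abs_choice a with h | h <;> rw [h]
    · exact ha
    · exact D.neg_mem ha
  obtain ⟨r, hr, hr0, hra⟩ := hD |a| haD (abs_pos.2 ha0) n hn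
  refine ⟨valueOf r hr0.ne', ⟨r, hr, hr0.ne', rfl⟩, Subtype.ext ?_⟩
  rw [ValueGroup.coe_nsmul, ← hγ, ← ArchimedeanClass.mk_abs a, ← hra, ArchimedeanClass.mk_pow]
  rfl

theorem exists_zsmul_eq_valueGroup [IsRealClosed M] (n : ℤ) (hn : n ≠ 0) (γ : ValueGroup M) :
    ∃ δ, n • δ = γ := by
  obtain ⟨δ, -, h⟩ := exists_zsmul_mem_valueSubgroup (D := ⊤) (fun a _ ha n hn => by
    obtain ⟨s, hs⟩ := IsRealClosed.exists_eq_pow_of_nonneg ha.le hn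
    refine ⟨|s|, trivial, ?_, by rw [← abs_pow, ← hs, abs_of_pos ha]⟩
    rw [abs_pos]
    rintro rfl
    rw [zero_pow hn] at hs
    exact ha.ne' hs) hn (γ := γ) (by
      obtain ⟨a, ha, h⟩ := exists_valueOf_eq γ
      exact mem_valueSet_iff.2 ⟨a, trivial, ha, h⟩)
  exact ⟨δ, h⟩

theorem ogLanguage_lt_symbol : ∃ r : ogLanguage.Relations 2, ∀ x : Fin 2 → ValueGroup M,
    Structure.RelMap r x ↔ x 0 < x 1 := ⟨.lt, fun _ => Iff.rfl⟩

theorem isAffineOver_ogLanguage (D : AddSubgroup (ValueGroup M)) : IsAffineOver ogLanguage D where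
  funMap n f := by
    cases f
    refine ⟨fun _ => 1, 0, zero_mem D, fun x => ?_⟩
    simp only [one_smul, Fin.sum_univ_two, _root_.add_zero]
    rfl
  relMap n r := by
    cases r
    refine ⟨![-1, 1], 0, zero_mem D, fun x => ?_⟩
    simp only [Fin.sum_univ_two, _root_.add_zero, Matrix.cons_val_zero, Matrix.cons_val_one,
      neg_smul, one_smul, lt_neg_add_iff_add_lt]
    exact Iff.rfl

end ValueGroupStructure

/-! ### The two implications. -/

section Main

open FirstOrder.Language Set

variable {L : FirstOrder.Language.{u, v}} {M : Type w} [Field M] [LinearOrder M]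
  [IsStrictOrderedRing M] [L.Structure M] (hexp : ExpandsOrderedField L M)

/-- Constant embedding of an ordered field in an ultrapower. -/
noncomputable def germConst {ι : Type*} (U : Ultrafilter ι) :
    M →+*o Filter.Germ (U : Filter ι) M where
  toFun a := (a : Filter.Germ (U : Filter ι) M)
  map_zero' := rfl
  map_one' := rfl
  map_add' _ _ := rfl
  map_mul' _ _ := rfl
  monotone' _ _ h := Filter.Germ.const_le h

include hexp in
/-- The sufficiency of the three conditions. -/
theorem isSaturated_of_conditions [IsRealClosed M] (homin : IsOMinimal L M) {κ : Cardinal.{w}}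
    (hκ : 0 < κ)
    (h : ∀ M' : L.Substructure M, DimOverPrimeLT L (M' : Set M) κ →
      (Nontrivial (ValueGroup M) ∧
        IsSaturated (ogLanguage[[valueSet (M' : Set M)]]) (ValueGroup M) κ) ∧
      Nonempty (ArchimedeanClass.FiniteResidueField M ≃+*o ℝ) ∧
      (∀ (l : Ordinal.{w}), ω ≤ l → ∀ a : Set.Iio l → M, (∀ ρ, a ρ ∈ M') →
        IsPseudoCauchy a → ∃ x : M, IsPseudoLimit a x)) :
    IsSaturated L M κ := by
  classical
  refine IsSaturated.of_determinedBy fun A hA => ⟨dcl L A, fun φ =>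
    exists_determinedBy hexp.lt_symbol homin (definable₁_realize φ), fun U => ?_⟩
  obtain ⟨B, hBA, hB⟩ := exists_subset_basis hexp.lt_symbol homin A
  obtain ⟨⟨hnt, hsat⟩, hres, hpc⟩ := h (dclSubstructure L A)
    ⟨B, hB, (Cardinal.mk_le_mk_of_subset hBA).trans_lt hA⟩
  have hval : ∀ S T : Set (ValueGroup M), S ⊆ valueSet (dcl L A) → T ⊆ valueSet (dcl L A) →
      (∀ s ∈ S, ∀ t ∈ T, s < t) → ∃ g, (∀ s ∈ S, s < g) ∧ ∀ t ∈ T, g < t := by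
    intro S T hS hT hST
    have := denselyOrdered_of_divisible (V := ValueGroup M) exists_zsmul_eq_valueGroup
    have hdef : ∀ i : S ⊕ T, (∅ : Set (ValueGroup M)).Definable₁
        (ogLanguage[[valueSet (dclSubstructure L A : Set M)]])
        (Sum.elim (fun s : S => Ioi s.1) (fun t : T => Iio t.1) i) := by
      rintro (s | t)
      · exact definable_iff_empty_definable_with_params.1
          (definable_Ioi ogLanguage_lt_symbol (hS s.2))
      · exact definable_iff_empty_definable_with_params.1
          (definable_Iio ogLanguage_lt_symbol (hT t.2))
    -- The endpoints are named by constants, so the type has no parameters, however many endpoints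
    -- there are. Nontriviality of G excludes extreme elements, which covers an empty `S` or `T`.
    obtain ⟨g, hg⟩ := hsat.exists_forall_mem (A := ∅) (by simpa using hκ) _ hdef fun t => by
      obtain ⟨m, h1, h2⟩ := Order.exists_between_finsets (t.toLeft.image Subtype.val)
        (t.toRight.image Subtype.val) (by
          intro a ha b hb
          obtain ⟨a, -, rfl⟩ := Finset.mem_image.1 ha
          obtain ⟨b, -, rfl⟩ := Finset.mem_image.1 hb
          exact hST _ a.2 _ b.2)
      refine ⟨m, ?_⟩
      rintro (s | s) hs
      · exact h1 _ (Finset.mem_image_of_mem _ (Finset.mem_toLeft.2 hs))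
      · exact h2 _ (Finset.mem_image_of_mem _ (Finset.mem_toRight.2 hs))
    exact ⟨g, fun s hs => hg (Sum.inl ⟨s, hs⟩), fun t ht => hg (Sum.inr ⟨t, ht⟩)⟩
  -- The class of the identity in the ultrapower satisfies d < [id] exactly when `Ioi d` is in `U`.
  obtain ⟨y, hy⟩ := exists_sameCut (germConst U) (dclSubfield hexp A)
    ((id : M → M) : Filter.Germ (U : Filter M) M) hval hres hpc
  refine ⟨y, fun d hd => ?_⟩
  rw [← (hy d hd).1, ← (hy d hd).2]
  exact ⟨Filter.Germ.coe_lt, Filter.Germ.coe_lt⟩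

include hexp in
theorem nontrivial_valueGroup_of_isSaturated {κ : Cardinal.{w}} (hκ : 0 < κ)
    (h : IsSaturated L M κ) : Nontrivial (ValueGroup M) := by
  obtain ⟨x, hx⟩ := h.exists_forall_mem (A := ∅) (by simpa using hκ)
    (fun n : ℕ => {x : M | n • |(1 : M)| < |x|})
    (fun n => definable₁_nsmul_lt_abs hexp (one_mem_dcl hexp) n) fun t => by
      refine ⟨(t.sup id + 1 : ℕ), fun n hn => ?_⟩
      have : n < t.sup id + 1 := Nat.lt_succ_of_le (Finset.le_sup (f := id) hn)
      rw [mem_ofPred_eq, Nat.abs_cast, abs_one, _root_.nsmul_eq_mul, mul_one]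
      exact Nat.cast_lt.2 this
  have hx0 : x ≠ 0 := by
    rintro rfl
    simpa using hx 0
  exact ⟨valueOf x hx0, valueOf 1 one_ne_zero, (valueOf_lt_iff.2 hx).ne⟩

include hexp in
theorem residueField_iso_of_isSaturated {κ : Cardinal.{w}} (hκ : 0 < κ)
    (h : IsSaturated L M κ) : Nonempty (ArchimedeanClass.FiniteResidueField M ≃+*o ℝ) := by
  classical
  refine nonempty_residueField_iso fun r => ?_
  have hq : ∀ q : ℚ, (q : M) ∈ dcl L (∅ : Set M) := fun q =>
    SubfieldClass.ratCast_mem (dclSubfield hexp ∅) q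
  have hdef : ∀ q : ℚ, (∅ : Set M).Definable₁ L
      {x : M | ((q : ℝ) < r → (q : M) < x) ∧ (r < q → x < (q : M))} := by
    intro q
    have h1 := definable_lt_field hexp (L.definableFun_const (Fin 1) (hq q))
      (DefinableFun.proj L (i := (0 : Fin 1)))
    have h2 := definable_lt_field hexp (DefinableFun.proj L (i := (0 : Fin 1)))
      (L.definableFun_const (Fin 1) (hq q))
    by_cases h3 : (q : ℝ) < r
    · simpa [Set.Definable₁, h3, h3.not_gt] using h1
    · by_cases h4 : r < q
      · simpa [Set.Definable₁, h3, h4] using h2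
      · simp [Set.Definable₁, h3, h4]
  obtain ⟨x, hx⟩ := h.exists_forall_mem (A := ∅) (by simpa using hκ) _ hdef fun t => by
    obtain ⟨m, h1, h2⟩ := Order.exists_between_finsets (t.filter fun q : ℚ => (q : ℝ) < r)
      (t.filter fun q : ℚ => r < q) (by
        intro a ha b hb
        exact Rat.cast_lt.1 ((Finset.mem_filter.1 ha).2.trans (Finset.mem_filter.1 hb).2))
    exact ⟨m, fun q hq => ⟨fun h => Rat.cast_lt.2 (h1 q (Finset.mem_filter.2 ⟨hq, h⟩)),
      fun h => Rat.cast_lt.2 (h2 q (Finset.mem_filter.2 ⟨hq, h⟩))⟩⟩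
  have hx0 : 0 ≤ ArchimedeanClass.mk x := by
    obtain ⟨n, hn⟩ := exists_nat_gt |r|
    rw [abs_lt] at hn
    have h1 := (hx (-n)).1 (by push_cast; exact hn.1)
    have h2 := (hx n).2 (by push_cast; exact hn.2)
    push_cast at h1 h2
    rw [← ArchimedeanClass.mk_one, ArchimedeanClass.mk_le_mk]
    exact ⟨n, by simpa using (abs_lt.2 ⟨h1, h2⟩).le⟩
  refine ⟨x, hx0, ?_⟩
  rcases lt_trichotomy (ArchimedeanClass.stdPart x) r with h' | h' | h'
  · obtain ⟨q, h1, h2⟩ := exists_rat_btwn h'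
    exact absurd (le_stdPart_ratCast hx0 ((hx q).1 h2).le) h1.not_ge
  · exact h'
  · obtain ⟨q, h1, h2⟩ := exists_rat_btwn h'
    exact absurd (stdPart_ratCast_le hx0 ((hx q).2 h1).le) h2.not_ge

include hexp in
-- If there is a last term, it is a pseudo-limit. Otherwise it is enough to have v(a_σ - a_ρ) < v(x
-- - a_σ) for all ρ < σ, a type over `B` that later terms satisfy finitely.
theorem exists_pseudoLimit_of_isSaturated {κ : Cardinal.{w}} (h : IsSaturated L M κ)
    {B : Set M} (hB : #B < κ) {l : Ordinal.{w}} (hl : 0 < l) {a : Set.Iio l → M}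
    (ha : ∀ ρ, a ρ ∈ dcl L B) (hpc : IsPseudoCauchy a) : ∃ x, IsPseudoLimit a x := by
  classical
  by_cases hmax : ∃ μ : Set.Iio l, ∀ ρ, ρ ≤ μ
  · obtain ⟨μ, hμ⟩ := hmax
    refine ⟨a μ, fun ρ σ hρσ => ?_⟩
    rcases (hμ σ).eq_or_lt with rfl | hσ
    · rfl
    · have := ArchimedeanClass.mk_add_eq_mk_right (hpc ρ σ μ hρσ hσ)
      rwa [sub_add_sub_cancel] at this
  · push Not at hmax
    have hne : Nonempty (Set.Iio l) := ⟨⟨0, hl⟩⟩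
    have : NoMaxOrder (Set.Iio l) := ⟨hmax⟩
    obtain ⟨x, hx⟩ := h.exists_forall_mem hB
      (fun p : {p : Set.Iio l × Set.Iio l // p.1 < p.2} × ℕ =>
        {x | p.2 • |x - a p.1.1.2| < |a p.1.1.2 - a p.1.1.1|})
      (fun p => definable₁_nsmul_abs_sub_lt hexp (ha _) (by
        have := (dclSubfield hexp B).sub_mem (ha p.1.1.2) (ha p.1.1.1)
        rcases abs_choice (a p.1.1.2 - a p.1.1.1) with h | h <;> rw [h]
        · exact this
        · exact (dclSubfield hexp B).neg_mem this) _) fun t => by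
      obtain ⟨μ, hμ⟩ := (t.image fun p => p.1.1.2).exists_le
      obtain ⟨τ, hτ⟩ := exists_gt μ
      exact ⟨a τ, fun p hp => ArchimedeanClass.mk_lt_mk.1 (hpc _ _ τ p.1.2
        ((hμ _ (Finset.mem_image_of_mem _ hp)).trans_lt hτ)) p.2⟩
    refine ⟨x, fun ρ σ hρσ => ?_⟩
    have : ArchimedeanClass.mk (a σ - a ρ) < ArchimedeanClass.mk (x - a σ) :=
      ArchimedeanClass.mk_lt_mk.2 fun n => hx ⟨⟨(ρ, σ), hρσ⟩, n⟩
    have := ArchimedeanClass.mk_add_eq_mk_right this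
    rwa [sub_add_sub_cancel] at this

include hexp in
/-- In a saturated `M`, the cuts over the values of a small definable closure are realized. -/
theorem exists_value_cut_of_isSaturated {κ : Cardinal.{w}} (h : IsSaturated L M κ)
    {E : Set M} (hE : #E < κ) (U : Ultrafilter (ValueGroup M)) :
    ∃ y, ∀ d ∈ valueSet (dcl L E), (d < y ↔ Ioi d ∈ U) ∧ (y < d ↔ Iio d ∈ U) := by
  classical
  -- If `U` concentrates on a value d, then d itself is the answer. Otherwise only strict
  -- inequalities are needed, and these pull back to M.
  by_cases hd : ∃ d ∈ valueSet (dcl L E), {d} ∈ U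
  · obtain ⟨y, -, hy⟩ := hd
    have key : ∀ S : Set (ValueGroup M), y ∈ S ↔ S ∈ U := by
      intro S
      constructor
      · exact fun h => Filter.mem_of_superset hy (singleton_subset_iff.2 h)
      · intro h
        obtain ⟨z, hz, hz'⟩ := U.nonempty_of_mem (Filter.inter_mem h hy)
        rwa [mem_singleton_iff.1 hz'] at hz
    exact ⟨y, fun d _ => ⟨key (Ioi d), key (Iio d)⟩⟩
  push Not at hd
  have hdef1 : E.Definable₁ L {x : M | x ≠ 0} :=
    definable_not (definable_of_dcl ((DefinableFun.proj L).ofPred_eq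
      (L.definableFun_const _ (zero_mem_dcl hexp))))
  have hdef2 : ∀ p : {a // a ∈ dcl L E ∧ a ≠ 0} × ℕ, E.Definable₁ L
      {x : M | (Ioi (valueOf p.1.1 p.1.2.2) ∈ U → p.2 • |x| < |p.1.1|) ∧
        (Iio (valueOf p.1.1 p.1.2.2) ∈ U → p.2 • |p.1.1| < |x|)} := by
    rintro ⟨⟨a, ha, ha0⟩, n⟩
    have habs : |a| ∈ dcl L E := by
      rcases abs_choice a with h | h <;> rw [h]
      · exact ha
      · exact (dclSubfield hexp E).neg_mem ha
    have h1 := definable₁_nsmul_abs_sub_lt hexp (zero_mem_dcl hexp) habs n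
    have h2 := definable₁_nsmul_lt_abs hexp ha n
    have hc : ∀ q : Prop, E.Definable L {_x : Fin 1 → M | q} := by
      intro q
      by_cases hq : q <;> simp [hq]
    simp only [_root_.sub_zero] at h1
    exact definable_and (definable_imp (hc _) h1) (definable_imp (hc _) h2)
  obtain ⟨x, hx⟩ := h.exists_forall_mem hE
    (fun i : Option ({a // a ∈ dcl L E ∧ a ≠ 0} × ℕ) => i.elim {x : M | x ≠ 0} fun p =>
      {x : M | (Ioi (valueOf p.1.1 p.1.2.2) ∈ U → p.2 • |x| < |p.1.1|) ∧
        (Iio (valueOf p.1.1 p.1.2.2) ∈ U → p.2 • |p.1.1| < |x|)})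
    (fun i => by
      rcases i with _ | p
      · exact hdef1
      · exact hdef2 p) fun t => by
    have hev : ∀ i ∈ t, ∀ᶠ γ in (U : Filter (ValueGroup M)), ∀ p, i = some p →
        (Ioi (valueOf p.1.1 p.1.2.2) ∈ U → valueOf p.1.1 p.1.2.2 < γ) ∧
        (Iio (valueOf p.1.1 p.1.2.2) ∈ U → γ < valueOf p.1.1 p.1.2.2) := by
      rintro (_ | p) -
      · simp
      · simp only [Option.some.injEq, forall_eq']
        have key : ∀ S : Set (ValueGroup M), ∀ᶠ γ in (U : Filter (ValueGroup M)), S ∈ U → γ ∈ S := by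
          intro S
          by_cases hS : S ∈ U
          · filter_upwards [hS] with γ hγ _ using hγ
          · simp [hS]
        exact (key _).and (key _)
    obtain ⟨γ, hγ⟩ := ((Filter.eventually_all_finset t).2 hev).exists
    obtain ⟨x, hx0, rfl⟩ := exists_valueOf_eq γ
    refine ⟨x, ?_⟩
    rintro (_ | p) hp
    · exact hx0
    · have := hγ _ hp p rfl
      exact ⟨fun h => valueOf_lt_iff.1 (this.1 h) _, fun h => valueOf_lt_iff.1 (this.2 h) _⟩
  have hx0 : x ≠ 0 := hx none
  refine ⟨valueOf x hx0, fun d hdE => ?_⟩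
  have hnd := hd d hdE
  obtain ⟨a, ha, ha0, rfl⟩ := mem_valueSet_iff.1 hdE
  have h1 : Ioi (valueOf a ha0) ∈ U → valueOf a ha0 < valueOf x hx0 := fun h =>
    valueOf_lt_iff.2 fun n => (hx (some (⟨a, ha, ha0⟩, n))).1 h
  have h2 : Iio (valueOf a ha0) ∈ U → valueOf x hx0 < valueOf a ha0 := fun h =>
    valueOf_lt_iff.2 fun n => (hx (some (⟨a, ha, ha0⟩, n))).2 h
  -- `U` avoids the singleton, so it contains exactly one of the two rays, and the one-way
  -- implications become equivalences.
  have h3 : Ioi (valueOf a ha0) ∈ U ∨ Iio (valueOf a ha0) ∈ U := by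
    rw [← Ultrafilter.union_mem_iff, Set.union_comm, Iio_union_Ioi]
    exact Ultrafilter.compl_mem_iff_notMem.2 hnd
  refine ⟨⟨fun h => h3.resolve_right fun h' => h.not_gt (h2 h'), h1⟩,
    ⟨fun h => h3.resolve_left fun h' => h.not_gt (h1 h'), h2⟩⟩

include hexp in
-- Adding to `B` one lift of each parameter gives a small `E` whose closure has every named value
-- and every parameter among its values.
theorem isSaturated_valueGroup [IsRealClosed M] {κ : Cardinal.{w}} (hκ : ℵ₀ ≤ κ)
    (h : IsSaturated L M κ) {B : Set M} (hB : #B < κ) {M' : Set M} (hM' : M' ⊆ dcl L B) :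
    IsSaturated (ogLanguage[[valueSet M']]) (ValueGroup M) κ := by
  have hnt := nontrivial_valueGroup_of_isSaturated hexp (aleph0_pos.trans_le hκ) h
  refine IsSaturated.of_determinedBy fun A hA => ?_
  choose lift hlift0 hlift using exists_valueOf_eq (M := M)
  have hE : #(B ∪ lift '' A : Set M) < κ :=
    (Cardinal.mk_union_le _ _).trans_lt (Cardinal.add_lt_of_lt hκ hB (mk_image_le.trans_lt hA))
  set E : Set M := B ∪ lift '' A
  refine ⟨valueSet (dcl L E), fun φ => ?_, exists_value_cut_of_isSaturated hexp h hE⟩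
  have hC : valueSet M' ⊆ valueSubgroup (dclSubfield hexp E) := by
    rintro γ ⟨a, ha, h⟩
    exact ⟨a, dcl_mono subset_union_left (hM' ha), h⟩
  have hAE : A ⊆ valueSubgroup (dclSubfield hexp E) := fun γ hγ =>
    mem_valueSet_iff.2 ⟨lift γ, subset_dcl (Or.inr ⟨γ, hγ, rfl⟩), hlift0 γ, hlift γ⟩
  refine exists_determinedBy_of_divisible (D := valueSubgroup (dclSubfield hexp E))
    exists_zsmul_eq_valueGroup
    (((isAffineOver_ogLanguage _).withConstants hC).withConstants hAE) (fun n hn γ hγ => ?_) φ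
  -- Division by n is possible within the subgroup and unique in G, so the quotient is `γ` itself.
  obtain ⟨δ, hδ, e⟩ := exists_zsmul_mem_valueSubgroup
    (fun a ha h0 n hn => exists_root_mem_dcl hexp ha h0 hn) hn hγ
  rwa [← zsmul_right_injective hn e]

end Main

end OMinSat

theorem theorem6p1 (L : FirstOrder.Language.{u, v}) (hL : L.card ≤ Cardinal.aleph0)
    (M : Type w) [Field M] [LinearOrder M] [IsStrictOrderedRing M] [IsRealClosed M]
    [L.Structure M] (hexp : OMinSat.ExpandsOrderedField L M) (homin : OMinSat.IsOMinimal L M)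
    (α : Ordinal.{w}) :
    OMinSat.IsSaturated L M (ℵ_ α) ↔
      ∀ M' : L.Substructure M, OMinSat.DimOverPrimeLT L (M' : Set M) (ℵ_ α) →
        -- the value group, with a constant naming each element of `v(M')`, is a nontrivial
        -- `ℵ_α`-saturated structure
        (Nontrivial (OMinSat.ValueGroup M) ∧
          OMinSat.IsSaturated (OMinSat.ogLanguage[[OMinSat.valueSet (M' : Set M)]])
            (OMinSat.ValueGroup M) (ℵ_ α)) ∧
        -- the residue field is isomorphic to `ℝ`
        Nonempty (ArchimedeanClass.FiniteResidueField M ≃+*o ℝ) ∧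
        -- every pseudo-Cauchy sequence in `M'` has a pseudo-limit in `M`
        (∀ (l : Ordinal.{w}), ω ≤ l → ∀ a : Set.Iio l → M, (∀ ρ, a ρ ∈ M') →
          OMinSat.IsPseudoCauchy a → ∃ x : M, OMinSat.IsPseudoLimit a x) := by
  have hκ : ℵ₀ ≤ ℵ_ α := aleph0_le_aleph α
  have hκ0 : 0 < ℵ_ α := aleph0_pos.trans_le hκ
  refine ⟨?_, OMinSat.isSaturated_of_conditions hexp homin hκ0⟩
  rintro h M' ⟨B, ⟨-, -, hB⟩, hBκ⟩
  rw [OMinSat.dcl_primeModel_union] at hB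
  exact ⟨⟨OMinSat.nontrivial_valueGroup_of_isSaturated hexp hκ0 h,
    OMinSat.isSaturated_valueGroup hexp hκ h hBκ hB⟩,
    OMinSat.residueField_iso_of_isSaturated hexp hκ0 h,
    fun l hl a ha hpc => OMinSat.exists_pseudoLimit_of_isSaturated hexp h hBκ
      (omega0_pos.trans_le hl) (fun ρ => hB (ha ρ)) hpc⟩
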